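/- Let $n\ge 1$ and $[n]=\{1,\dots,n\}$. A family $(\sigma_1,\dots,\sigma_m)$ of subsets of $[n]$ is an $s$-cover of $[n]$ if every $i\in[n]$ lies in exactly $s$ of the sets $\sigma_j$ (counted with multiplicity); an $s$-cover is $1$-reducible if its members can be distributed into $s$ groups, each of which is a $1$-cover of $[n]$. For $\tau\subseteq[n]$ let $H_\tau=\mathrm{span}\{e_i:i\in\tau\}\subseteq\mathbb R^n$; integrals over $H_\tau$ are with respect to $|\tau|$-dimensional Lebesgue measure, which for $\tau=\emptyset$ is the unit mass at $0$. Let $f:\mathbb R^n\to[0,\infty)$ be integrable and log-concave, i.e. $f((1-\lambda)x+\lambda y)\ge f(x)^{1-\lambda}f(y)^{\lambda}$ for all $x,y\in\mathbb R^n$, $\lambda\in[0,1]$. Let $\|f\|_\infty=\sup_{x\in\mathbb R^n} f(x)$, and use the convention $0\cdot\infty=0$. Let $(\sigma_1,\dots,\sigma_m)$ be a $1$-reducible $s$-cover of $[n]$. Then $$\|f\|_\infty^{m-s}\Big(\int_{\mathbb R^n}f(x)\,dx\Big)^s\ \ge\ \frac{\prod_{j=1}^m|\sigma_j|!}{n!^s}\prod_{j=1}^m\int_{H_{\sigma_j}}f(x)\,dx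 .$$ Moreover, assume that at least one $\sigma_j$ satisfies $\emptyset\ne\sigma_j\ne[n]$ (if all $\sigma_j$ are nonempty, this means $m>s$). Let $(\overline\sigma_1,\dots,\overline\sigma_k)$ be the $1$-cover of $[n]$ induced by $(\sigma_1,\dots,\sigma_m)$, i.e. the list of all distinct nonempty sets of the form $\bigcap_{j=1}^m\sigma_j^{\varepsilon(j)}$ with $\varepsilon(j)\in\{0,1\}$, $\sigma_j^0=\sigma_j$, $\sigma_j^1=[n]\setminus\sigma_j$. Then equality holds if and only if either $\int_{\mathbb R^n} f=0$ (in which case both sides vanish) or $$f=\|f\|_\infty\,\chi_C,\qquad C=\mathrm{conv}\Big(\bigcup_{j=1}^k\{0\}^{|\overline\sigma_1|}\times\dots\times\{0\}^{|\overline\sigma_{j-1}|}\times K_j\times\{0\}^{|\overline\sigma_{j+1}|}\times\dots\times\{0\}^{|\overline\sigma_k|}\Big)$$ for some convex bodies (compact convex sets with nonempty interior) $K_j\subset\mathbb R^{\overline\sigma_j}$ with $0\in K_j$, $j=1,\dots,k$, where the $j$-th factor stands for the coordinates in $\overline\sigma_j$. Here $f=\|f\|_\infty\chi_C$ means equality almost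 everywhere on $\mathbb R^n$ and, for each $j=1,\dots,m$, almost everywhere on $H_{\sigma_j}$; if $f$ is upper semicontinuous, the same characterization holds with $f=\|f\|_\infty\chi_C$ everywhere on $\mathbb R^n$. -/

import Mathlib

open MeasureTheory Set
open scoped ENNReal

namespace RogersShephard

/-- `f : ℝⁿ → [0, ∞)` is log-concave. -/
def IsLogConcave {n : ℕ} (f : (Fin n → ℝ) → ℝ) : Prop :=
  (∀ x, 0 ≤ f x) ∧
    ∀ (x y : Fin n → ℝ) (a b : ℝ), 0 ≤ a → 0 ≤ b → a + b = 1 →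
      f x ^ a * f y ^ b ≤ f (a • x + b • y)

/-- The family `σ` of subsets of `[n]` is an `s`-cover of `[n]`: every element of `[n]` lies in
exactly `s` members of the family. -/
def IsCover {n : ℕ} {ι : Type} [Fintype ι] (s : ℕ) (σ : ι → Finset (Fin n)) : Prop :=
  ∀ i : Fin n, (Finset.univ.filter fun j => i ∈ σ j).card = s

/-- The `s`-cover `σ` is `1`-reducible: its members can be distributed into `s` groups, each of
which is a `1`-cover of `[n]`. -/
def IsOneReducible {n m : ℕ} (s : ℕ) (σ : Fin m → Finset (Fin n)) : Prop :=
  ∃ g : Fin m → Fin s, ∀ t : Fin s, IsCover 1 fun j : {j : Fin m // g j = t} => σ j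

/-- The `1`-cover induced by `σ`: all nonempty sets `⋂ⱼ σⱼ^{ε(j)}`, where each `σⱼ^{ε(j)}` is
either `σⱼ` or its complement in `[n]`. -/
def inducedCover {n m : ℕ} (σ : Fin m → Finset (Fin n)) : Finset (Finset (Fin n)) :=
  (Finset.univ.image fun ε : Fin m → Bool =>
    Finset.univ.filter fun i => ∀ j, i ∈ (if ε j then (σ j)ᶜ else σ j)).filter Finset.Nonempty

/-- The parametrization of the coordinate subspace `H_τ = span {eᵢ : i ∈ τ}` of `ℝⁿ` by
`ℝ^τ`, extending a vector by zero outside `τ`. -/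
def embed {n : ℕ} (τ : Finset (Fin n)) (y : τ → ℝ) : Fin n → ℝ :=
  fun i => if h : i ∈ τ then y ⟨i, h⟩ else 0

/-- The `|τ|`-dimensional Lebesgue measure on `H_τ`, as a measure on `ℝⁿ`; for `τ = ∅` it is the
Dirac mass at the origin. -/
noncomputable def sectionMeasure {n : ℕ} (τ : Finset (Fin n)) : Measure (Fin n → ℝ) :=
  (volume : Measure (τ → ℝ)).map (embed τ)

/-- A convex body: a compact convex set with nonempty interior. -/
def IsConvexBody {ι : Type} (K : Set (ι → ℝ)) : Prop :=
  IsCompact K ∧ Convex ℝ K ∧ (interior K).Nonempty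

/-- `‖f‖_∞`, the supremum of `|f|`. -/
noncomputable def supNorm {n : ℕ} (f : (Fin n → ℝ) → ℝ) : ℝ≥0∞ := ⨆ x, ‖f x‖ₑ

/-- `‖f‖_∞^{m-s} (∫ f)^s`. -/
noncomputable def leftSide {n : ℕ} (m s : ℕ) (f : (Fin n → ℝ) → ℝ) : ℝ≥0∞ :=
  supNorm f ^ (m - s) * (∫⁻ x, ENNReal.ofReal (f x)) ^ s

/-- `(∏ⱼ |σⱼ|! / n!^s) ∏ⱼ ∫_{H_{σⱼ}} f`. -/
noncomputable def rightSide {n m : ℕ} (s : ℕ) (σ : Fin m → Finset (Fin n))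
    (f : (Fin n → ℝ) → ℝ) : ℝ≥0∞ :=
  (∏ j, ((σ j).card.factorial : ℝ≥0∞)) / (n.factorial : ℝ≥0∞) ^ s *
    ∏ j, ∫⁻ x, ENNReal.ofReal (f x) ∂(sectionMeasure (σ j))

/-- `C` is the convex hull of sets `{0} × ⋯ × {0} × K_τ × {0} × ⋯ × {0}`, where `τ` runs through
the blocks of the `1`-cover induced by `σ` and each `K_τ` is a convex body in `ℝ^τ` that
contains the origin. -/
def IsBlockHull {n m : ℕ} (σ : Fin m → Finset (Fin n)) (C : Set (Fin n → ℝ)) : Prop :=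
  ∃ K : (τ : Finset (Fin n)) → Set (τ → ℝ),
    (∀ τ ∈ inducedCover σ, IsConvexBody (K τ) ∧ 0 ∈ K τ) ∧
      C = convexHull ℝ (⋃ τ ∈ inducedCover σ, embed τ '' K τ)

/-- `f` and `‖f‖_∞ χ_C` agree at the point `x`. -/
def AgreesAt {n : ℕ} (f : (Fin n → ℝ) → ℝ) (C : Set (Fin n → ℝ)) (x : Fin n → ℝ) : Prop :=
  ENNReal.ofReal (f x) = supNorm f * C.indicator 1 x

end RogersShephard

/-! Write w(S) = |S|! ∫_{H_S} f, the quantity `weight f S`. After division by ‖f‖_∞ the claim is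
that ∏ w(σ_j) ≤ w([n])^s for a log-concave f ≤ 1. Splitting the cover into its s one-covers, this
follows from w(S) w(T) ≤ w(S ∪ T) for disjoint S, T.

The factorials come from an exponential random variable r: since E r^k = k!, scaling shows that w(S)
is the integral over H_S of G(x) = E f(x/r) (`rayIntegral`, `factorial_mul_lintegral`). By Fubini on
H_S ⊕ H_T it is enough that G(x) G(y) ≤ G(x + y). Log-concavity bounds f((x + y)/(r₁ + r₂)) below by
a weighted geometric mean of f(x/r₁) and f(y/r₂), so superlevel sets along the three rays satisfy A
+ B ⊆ D. The exponential law gives P(A) P(B) ≤ P(D), as e^{-r} is multiplicative, and integration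
over levels in (0, 1] with Chebyshev's inequality for monotone functions finishes
(`integral_mul_integral_le`).

In the equality case (`exists_thresholds`) Chebyshev makes one of the level functions constant, so f
jumps from 0 to 1 along that ray; the weights in the geometric mean carry this to the other ray, and
the jump radii add. Hence f is the indicator of a convex body C containing 0 whose gauge is additive
over H_S ⊕ H_{Sᶜ}, which is `SplitsAlong`. Splitting along all σ_j in turn gives the hull over the
induced blocks (`isBlockHull_of_splitsAlong`). Conversely such a hull splits along each σ_j, and
splitting reverses the inequality for G (`SplitsAlong.rayIntegral_add_le`). -/

namespace RogersShephard

/-! ### The exponential distribution. -/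

/-- The standard exponential distribution on `(0, ∞)`. -/
noncomputable def expo : Measure ℝ :=
  (volume.restrict (Ioi 0)).withDensity fun r => ENNReal.ofReal (Real.exp (-r))

lemma measurable_expo_density : Measurable fun r : ℝ => ENNReal.ofReal (Real.exp (-r)) := by
  fun_prop

lemma lintegral_expo {φ : ℝ → ℝ≥0∞} (hφ : Measurable φ) :
    ∫⁻ r, φ r ∂expo = ∫⁻ r in Ioi 0, ENNReal.ofReal (Real.exp (-r)) * φ r := by
  rw [expo, lintegral_withDensity_eq_lintegral_mul _ measurable_expo_density hφ]
  rfl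

lemma ae_expo_iff {p : ℝ → Prop} :
    (∀ᵐ r ∂expo, p r) ↔ ∀ᵐ r ∂(volume : Measure ℝ), 0 < r → p r := by
  rw [expo, ae_withDensity_iff measurable_expo_density, ae_restrict_iff' measurableSet_Ioi]
  simp [Real.exp_pos]

lemma ae_expo_pos : ∀ᵐ r ∂expo, 0 < r := ae_expo_iff.2 (by simp)

lemma exists_mem_Ioo_of_ae_expo {p : ℝ → Prop} (h : ∀ᵐ r ∂expo, p r) {a b : ℝ} (ha : 0 ≤ a)
    (hab : a < b) : ∃ r ∈ Ioo a b, p r := by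
  by_contra! hno
  have h2 : ∀ᵐ r ∂(volume : Measure ℝ), r ∉ Ioo a b := by
    filter_upwards [ae_expo_iff.1 h] with r hr hr'
    exact hno r hr' (hr (ha.trans_lt hr'.1))
  rw [← measure_eq_zero_iff_ae_notMem, Real.volume_Ioo] at h2
  simp at h2
  linarith

lemma expo_Ioi {a : ℝ} (ha : 0 ≤ a) : expo (Ioi a) = ENNReal.ofReal (Real.exp (-a)) := by
  have h : expo (Ioi a) = ∫⁻ r in Ioi a, ENNReal.ofReal (Real.exp (-r)) := by
    rw [expo, withDensity_apply _ measurableSet_Ioi, Measure.restrict_restrict measurableSet_Ioi,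
      Ioi_inter_Ioi, sup_eq_left.2 ha]
  rw [h, ← integral_exp_neg_Ioi a, ofReal_integral_eq_lintegral_ofReal]
  · exact integrableOn_exp_neg_Ioi a
  · exact ae_of_all _ fun r => (Real.exp_pos _).le

instance : IsProbabilityMeasure expo := by
  constructor
  have h : expo univ = expo (Ioi 0) :=
    measure_congr <| Filter.eventuallyEq_set.2 <| by
      filter_upwards [ae_expo_pos] with r hr using by simpa using hr
  rw [h, expo_Ioi le_rfl]
  simp

instance : NullSingletonClass expo := by
  unfold expo; infer_instance

lemma expo_real_Ioi {a : ℝ} (ha : 0 ≤ a) : expo.real (Ioi a) = Real.exp (-a) := by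
  rw [measureReal_def, expo_Ioi ha, ENNReal.toReal_ofReal (Real.exp_pos _).le]

/-- Memorylessness: the density at a + r is e^{-a} times the density at r. Only an inequality
remains because the mass of φ on (0, a] is discarded. -/
lemma lintegral_expo_shift {a : ℝ} (ha : 0 ≤ a) {φ : ℝ → ℝ≥0∞} (hφ : Measurable φ) :
    ENNReal.ofReal (Real.exp (-a)) * ∫⁻ r, φ (a + r) ∂expo ≤ ∫⁻ r, φ r ∂expo := by
  rw [lintegral_expo hφ, lintegral_expo (by fun_prop), ← lintegral_const_mul _ (by fun_prop),
    ← lintegral_indicator measurableSet_Ioi, ← lintegral_indicator measurableSet_Ioi,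
    ← lintegral_add_left_eq_self (μ := (volume : Measure ℝ))
      ((Ioi 0).indicator fun r => ENNReal.ofReal (Real.exp (-r)) * φ r) a]
  refine lintegral_mono fun r => ?_
  by_cases hr : 0 < r
  · rw [indicator_of_mem (by exact hr), indicator_of_mem (by simp only [mem_Ioi]; linarith),
      ← mul_assoc, ← ENNReal.ofReal_mul (Real.exp_pos _).le, ← Real.exp_add, neg_add]
  · simp [indicator_of_notMem, hr]

lemma expo_shift {a : ℝ} (ha : 0 ≤ a) {A B : Set ℝ} (hA : MeasurableSet A)
    (h : ∀ r, 0 < r → r ∈ B → a + r ∈ A) :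
    Real.exp (-a) * expo.real B ≤ expo.real A := by
  have key := lintegral_expo_shift ha (φ := A.indicator 1) (measurable_one.indicator hA)
  rw [lintegral_indicator_one hA] at key
  have h2 : expo B ≤ ∫⁻ r, A.indicator 1 (a + r) ∂expo := by
    have : ∫⁻ r, A.indicator (1 : ℝ → ℝ≥0∞) (a + r) ∂expo = expo ((fun r => a + r) ⁻¹' A) := by
      rw [← lintegral_indicator_one (hA.preimage (by fun_prop))]
      rfl
    rw [this]
    refine measure_mono_ae ?_
    filter_upwards [ae_expo_pos] with r hr hB using h r hr hB
  have h3 := (mul_le_mul_right h2 (ENNReal.ofReal (Real.exp (-a)))).trans key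
  have h4 := ENNReal.toReal_mono (measure_ne_top _ _) h3
  rwa [ENNReal.toReal_mul, ENNReal.toReal_ofReal (Real.exp_pos _).le] at h4

/-- Euler's integral for Γ(k + 1); this is the source of all factorials in the theorem. -/
lemma lintegral_expo_pow (k : ℕ) :
    ∫⁻ r, ENNReal.ofReal (r ^ k) ∂expo = (k.factorial : ℝ≥0∞) := by
  rw [lintegral_expo (by fun_prop)]
  have h := Real.Gamma_eq_integral (s := k + 1) (by positivity)
  have h2 := Real.GammaIntegral_convergent (s := k + 1) (by positivity)
  rw [Real.Gamma_nat_eq_factorial] at h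
  simp only [add_sub_cancel_right, Real.rpow_natCast] at h h2
  have h3 : ((k.factorial : ℕ) : ℝ≥0∞) = ENNReal.ofReal (k.factorial : ℝ) := by simp
  rw [h3, h, ofReal_integral_eq_lintegral_ofReal h2]
  · refine lintegral_congr fun r => ?_
    rw [ENNReal.ofReal_mul (Real.exp_pos _).le]
  · filter_upwards [ae_restrict_mem measurableSet_Ioi] with r hr
    have : (0 : ℝ) < r := hr
    simp only [Pi.zero_apply]; positivity

/-! ### Chebyshev's integral inequality and its equality case. -/

section Chebyshev

variable {ν : Measure ℝ} [IsProbabilityMeasure ν] {F H : ℝ → ℝ}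

/-- Symmetrization over two independent copies turns the defect in Chebyshev's inequality into the
integral of a product which is nonnegative for antitone functions. -/
lemma integral_prod_sub_mul_sub (hF : Integrable F ν) (hH : Integrable H ν)
    (hFH : Integrable (fun t => F t * H t) ν) :
    Integrable (fun p : ℝ × ℝ => (F p.1 - F p.2) * (H p.1 - H p.2)) (ν.prod ν) ∧
    ∫ p : ℝ × ℝ, (F p.1 - F p.2) * (H p.1 - H p.2) ∂(ν.prod ν) =
      2 * (∫ t, F t * H t ∂ν) - 2 * ((∫ t, F t ∂ν) * ∫ t, H t ∂ν) := by
  have i1 : Integrable (fun p : ℝ × ℝ => F p.1 * H p.1) (ν.prod ν) := hFH.comp_fst ν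
  have i2 : Integrable (fun p : ℝ × ℝ => F p.2 * H p.2) (ν.prod ν) := hFH.comp_snd ν
  have i3 : Integrable (fun p : ℝ × ℝ => F p.1 * H p.2) (ν.prod ν) := hF.mul_prod hH
  have i4 : Integrable (fun p : ℝ × ℝ => H p.1 * F p.2) (ν.prod ν) := hH.mul_prod hF
  have e : (fun p : ℝ × ℝ => (F p.1 - F p.2) * (H p.1 - H p.2)) =
      fun p => (F p.1 * H p.1 + F p.2 * H p.2) - (F p.1 * H p.2 + H p.1 * F p.2) := by
    ext p; ring
  have e1 : ∫ p : ℝ × ℝ, F p.1 * H p.1 ∂(ν.prod ν) = ∫ t, F t * H t ∂ν := by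
    simpa using integral_fun_fst (μ := ν) (ν := ν) (fun t => F t * H t)
  have e2 : ∫ p : ℝ × ℝ, F p.2 * H p.2 ∂(ν.prod ν) = ∫ t, F t * H t ∂ν := by
    simpa using integral_fun_snd (μ := ν) (ν := ν) (fun t => F t * H t)
  refine ⟨?_, ?_⟩
  · rw [e]; exact (i1.add i2).sub (i3.add i4)
  · have i12 : Integrable (fun p : ℝ × ℝ => F p.1 * H p.1 + F p.2 * H p.2) (ν.prod ν) := i1.add i2
    have i34 : Integrable (fun p : ℝ × ℝ => F p.1 * H p.2 + H p.1 * F p.2) (ν.prod ν) := i3.add i4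
    rw [e, integral_sub i12 i34, integral_add i1 i2, integral_add i3 i4, e1, e2,
      integral_prod_mul F H, integral_prod_mul H F]
    ring

lemma sub_mul_sub_nonneg (hF : Antitone F) (hH : Antitone H) (p : ℝ × ℝ) :
    0 ≤ (F p.1 - F p.2) * (H p.1 - H p.2) := by
  rcases le_total p.1 p.2 with h | h
  · exact mul_nonneg (sub_nonneg.2 (hF h)) (sub_nonneg.2 (hH h))
  · exact mul_nonneg_of_nonpos_of_nonpos (sub_nonpos.2 (hF h)) (sub_nonpos.2 (hH h))

/-- Chebyshev's integral inequality for antitone functions. -/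
lemma chebyshev (hF : Antitone F) (hH : Antitone H) (iF : Integrable F ν) (iH : Integrable H ν)
    (iFH : Integrable (fun t => F t * H t) ν) :
    (∫ t, F t ∂ν) * (∫ t, H t ∂ν) ≤ ∫ t, F t * H t ∂ν := by
  have h := (integral_prod_sub_mul_sub iF iH iFH).2
  have h2 : 0 ≤ ∫ p : ℝ × ℝ, (F p.1 - F p.2) * (H p.1 - H p.2) ∂(ν.prod ν) :=
    integral_nonneg (sub_mul_sub_nonneg hF hH)
  linarith

/-- If both functions vary on (0, 1), the product of differences is strictly positive on a box with
one side near 0 and the other near 1. Such a box has positive measure, which contradicts equality.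
-/
lemma chebyshev_eq (hF : Antitone F) (hH : Antitone H) (iF : Integrable F ν) (iH : Integrable H ν)
    (iFH : Integrable (fun t => F t * H t) ν)
    (h : ∫ t, F t * H t ∂ν ≤ (∫ t, F t ∂ν) * (∫ t, H t ∂ν))
    (hν : ∀ a b : ℝ, 0 ≤ a → a < b → b ≤ 1 → 0 < ν (Ioo a b)) :
    (∀ s ∈ Ioo (0 : ℝ) 1, ∀ t ∈ Ioo (0 : ℝ) 1, F s = F t) ∨
      ∀ s ∈ Ioo (0 : ℝ) 1, ∀ t ∈ Ioo (0 : ℝ) 1, H s = H t := by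
  obtain ⟨i, e⟩ := integral_prod_sub_mul_sub iF iH iFH
  have h0 : ∫ p : ℝ × ℝ, (F p.1 - F p.2) * (H p.1 - H p.2) ∂(ν.prod ν) = 0 :=
    le_antisymm (by linarith) (integral_nonneg (sub_mul_sub_nonneg hF hH))
  rw [integral_eq_zero_iff_of_nonneg (sub_mul_sub_nonneg hF hH) i] at h0
  have strict : ∀ {K : ℝ → ℝ}, Antitone K →
      ¬ (∀ s ∈ Ioo (0 : ℝ) 1, ∀ t ∈ Ioo (0 : ℝ) 1, K s = K t) →
      ∃ s ∈ Ioo (0 : ℝ) 1, ∃ t ∈ Ioo (0 : ℝ) 1, K t < K s := by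
    intro K hK hn
    push Not at hn
    obtain ⟨s, hs, t, ht, hne⟩ := hn
    rcases lt_or_gt_of_ne hne with h | h
    · exact ⟨t, ht, s, hs, h⟩
    · exact ⟨s, hs, t, ht, h⟩
  by_contra! hcon
  obtain ⟨s, hs, t, ht, h1⟩ := strict hF (by push Not; exact hcon.1)
  obtain ⟨s', hs', t', ht', h2⟩ := strict hH (by push Not; exact hcon.2)
  have hpos : 0 < (ν.prod ν) (Ioo 0 (min s s') ×ˢ Ioo (max t t') 1) := by
    rw [Measure.prod_prod]
    refine ENNReal.mul_pos (hν _ _ le_rfl (lt_min hs.1 hs'.1) (min_le_of_left_le hs.2.le)).ne'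
      (hν _ _ (le_max_of_le_left ht.1.le) (max_lt ht.2 ht'.2) le_rfl).ne'
  refine hpos.ne' (measure_mono_null ?_ (ae_iff.1 h0))
  rintro ⟨x, y⟩ ⟨hx, hy⟩
  have a1 := hF (hx.2.le.trans (min_le_left _ _))
  have a2 := hH (hx.2.le.trans (min_le_right _ _))
  have a3 := hF ((le_max_left _ _).trans hy.1.le)
  have a4 := hH ((le_max_right _ _).trans hy.1.le)
  have p1 : 0 < F x - F y := by dsimp only at *; linarith
  have p2 : 0 < H x - H y := by dsimp only at *; linarith
  exact (mul_pos p1 p2).ne'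

end Chebyshev

/-! ### The one-dimensional inequality by superlevel sets. -/

/-- The exponential measure of the superlevel set `{φ ≥ t}`. -/
noncomputable def level (φ : ℝ → ℝ) (t : ℝ) : ℝ := expo.real {r | t ≤ φ r}

section Level

variable {φ φ₁ φ₂ : ℝ → ℝ}

lemma level_nonneg (t : ℝ) : 0 ≤ level φ t := measureReal_nonneg

lemma level_le_one (t : ℝ) : level φ t ≤ 1 := measureReal_le_one

lemma level_antitone : Antitone (level φ) := fun _ _ h =>
  measureReal_mono fun _ hr => le_trans h hr

lemma integrable_level {ν : Measure ℝ} [IsFiniteMeasure ν] : Integrable (level φ) ν :=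
  Integrable.of_bound level_antitone.measurable.aestronglyMeasurable 1
    (ae_of_all _ fun t => by rw [Real.norm_of_nonneg (level_nonneg t)]; exact level_le_one t)

lemma integrable_level_mul {ν : Measure ℝ} [IsFiniteMeasure ν] :
    Integrable (fun t => level φ₁ t * level φ₂ t) ν :=
  Integrable.of_bound
    (level_antitone.measurable.mul level_antitone.measurable).aestronglyMeasurable 1
    (ae_of_all _ fun t => by
      rw [Real.norm_of_nonneg (mul_nonneg (level_nonneg t) (level_nonneg t))]
      exact mul_le_one₀ (level_le_one t) (level_nonneg t) (level_le_one t))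

lemma integrable_expo (hm : Measurable φ) (h0 : ∀ r, 0 ≤ φ r) (h1 : ∀ r, φ r ≤ 1) :
    Integrable φ expo :=
  Integrable.of_bound hm.aestronglyMeasurable 1
    (ae_of_all _ fun r => by rw [Real.norm_of_nonneg (h0 r)]; exact h1 r)

lemma integral_eq_level (hm : Measurable φ) (h0 : ∀ r, 0 ≤ φ r) (h1 : ∀ r, φ r ≤ 1) :
    ∫ r, φ r ∂expo = ∫ t in Ioc 0 1, level φ t :=
  (integrable_expo hm h0 h1).integral_eq_integral_Ioc_meas_le (ae_of_all _ h0) (ae_of_all _ h1)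

instance : IsProbabilityMeasure (volume.restrict (Ioc (0 : ℝ) 1)) := ⟨by simp⟩

/-- N is the infimum of {φ₁ ≥ t}. Points of that set just above N translate {φ₂ ≥ t} into {φ ≥ t},
while the set itself lies in [N, ∞). The two bounds are kept apart because equality in their product
must later identify N. -/
lemma exists_left_end (hm : Measurable φ) {t : ℝ}
    (h : ∀ r₁ r₂, 0 < r₁ → 0 < r₂ → min (φ₁ r₁) (φ₂ r₂) ≤ φ (r₁ + r₂)) (hne : level φ₁ t ≠ 0) :
    ∃ N, 0 ≤ N ∧ (∀ a, 0 < a → t ≤ φ₁ a → N ≤ a) ∧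
      Real.exp (-N) * level φ₂ t ≤ level φ t ∧ level φ₁ t ≤ Real.exp (-N) := by
  set A : Set ℝ := {a | 0 < a ∧ t ≤ φ₁ a} with hA
  have hAne : A.Nonempty := by
    by_contra hcon
    rw [not_nonempty_iff_eq_empty] at hcon
    refine hne ?_
    rw [level, measureReal_def, measure_eq_zero_iff_ae_notMem.2, ENNReal.toReal_zero]
    filter_upwards [ae_expo_pos] with r hr hr2
    have : r ∈ A := ⟨hr, hr2⟩
    rw [hcon] at this; exact this
  have hb : BddBelow A := ⟨0, fun a ha => ha.1.le⟩
  have hN : 0 ≤ sInf A := le_csInf hAne fun a ha => ha.1.le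
  have hle : ∀ a, 0 < a → t ≤ φ₁ a → sInf A ≤ a := fun a ha hta => csInf_le hb ⟨ha, hta⟩
  refine ⟨sInf A, hN, hle, ?_, ?_⟩
  · by_contra! hcon
    have hc : ContinuousAt (fun a => Real.exp (-a) * level φ₂ t) (sInf A) := by fun_prop
    obtain ⟨δ, hδ, hball⟩ := Metric.eventually_nhds_iff.1 (hc.eventually (lt_mem_nhds hcon))
    obtain ⟨a, ha, haδ⟩ := exists_lt_of_csInf_lt hAne (lt_add_of_pos_right (sInf A) hδ)
    have h2 := hball (y := a) (by
      rw [Real.dist_eq, abs_of_nonneg (sub_nonneg.2 (csInf_le hb ha))]; linarith)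
    refine absurd h2 (not_lt.2 (expo_shift ha.1.le (hm measurableSet_Ici) ?_))
    intro r hr hrB
    exact (le_min ha.2 hrB).trans (h a r ha.1 hr)
  · rw [← expo_real_Ioi hN, level]
    refine ENNReal.toReal_mono (measure_ne_top _ _) (measure_mono_ae ?_)
    filter_upwards [ae_expo_pos, Measure.ae_ne expo (sInf A)] with r hr hr2 hr3
    exact lt_of_le_of_ne (hle r hr hr3) hr2.symm

lemma level_mul_le (hm : Measurable φ)
    (h : ∀ r₁ r₂, 0 < r₁ → 0 < r₂ → min (φ₁ r₁) (φ₂ r₂) ≤ φ (r₁ + r₂)) (t : ℝ) :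
    level φ₁ t * level φ₂ t ≤ level φ t := by
  by_cases hne : level φ₁ t = 0
  · rw [hne, zero_mul]; exact level_nonneg t
  · obtain ⟨N, -, -, h1, h2⟩ := exists_left_end (φ₂ := φ₂) hm h hne
    exact (mul_le_mul_of_nonneg_right h2 (level_nonneg t)).trans h1

/-- Layer-cake formula on each side, then Chebyshev for the two level functions, then the pointwise
bound `level_mul_le`. -/
lemma integral_mul_integral_le (hm : Measurable φ) (h0 : ∀ r, 0 ≤ φ r) (h1 : ∀ r, φ r ≤ 1)
    (hm₁ : Measurable φ₁) (h0₁ : ∀ r, 0 ≤ φ₁ r) (h1₁ : ∀ r, φ₁ r ≤ 1)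
    (hm₂ : Measurable φ₂) (h0₂ : ∀ r, 0 ≤ φ₂ r) (h1₂ : ∀ r, φ₂ r ≤ 1)
    (h : ∀ r₁ r₂, 0 < r₁ → 0 < r₂ → min (φ₁ r₁) (φ₂ r₂) ≤ φ (r₁ + r₂)) :
    (∫ r, φ₁ r ∂expo) * (∫ r, φ₂ r ∂expo) ≤ ∫ r, φ r ∂expo := by
  rw [integral_eq_level hm h0 h1, integral_eq_level hm₁ h0₁ h1₁, integral_eq_level hm₂ h0₂ h1₂]
  exact (chebyshev level_antitone level_antitone integrable_level integrable_level
    integrable_level_mul).trans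
    (integral_mono integrable_level_mul integrable_level (level_mul_le hm h))

lemma volume_restrict_Ioo_pos {a b : ℝ} (ha : 0 ≤ a) (hab : a < b) (hb : b ≤ 1) :
    0 < volume.restrict (Ioc (0 : ℝ) 1) (Ioo a b) := by
  have hsub : Ioo a b ⊆ Ioc 0 1 := fun x hx => ⟨ha.trans_lt hx.1, hx.2.le.trans hb⟩
  rw [Measure.restrict_apply measurableSet_Ioo, inter_eq_left.2 hsub, Real.volume_Ioo]
  simpa using hab

lemma integral_mul_integral_eq (hm : Measurable φ) (h0 : ∀ r, 0 ≤ φ r) (h1 : ∀ r, φ r ≤ 1)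
    (hm₁ : Measurable φ₁) (h0₁ : ∀ r, 0 ≤ φ₁ r) (h1₁ : ∀ r, φ₁ r ≤ 1)
    (hm₂ : Measurable φ₂) (h0₂ : ∀ r, 0 ≤ φ₂ r) (h1₂ : ∀ r, φ₂ r ≤ 1)
    (h : ∀ r₁ r₂, 0 < r₁ → 0 < r₂ → min (φ₁ r₁) (φ₂ r₂) ≤ φ (r₁ + r₂))
    (heq : ∫ r, φ r ∂expo ≤ (∫ r, φ₁ r ∂expo) * (∫ r, φ₂ r ∂expo)) :
    (∀ᵐ t ∂(volume.restrict (Ioc (0 : ℝ) 1)), level φ₁ t * level φ₂ t = level φ t) ∧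
    ((∀ s ∈ Ioo (0 : ℝ) 1, ∀ t ∈ Ioo (0 : ℝ) 1, level φ₁ s = level φ₁ t) ∨
      ∀ s ∈ Ioo (0 : ℝ) 1, ∀ t ∈ Ioo (0 : ℝ) 1, level φ₂ s = level φ₂ t) := by
  rw [integral_eq_level hm h0 h1, integral_eq_level hm₁ h0₁ h1₁, integral_eq_level hm₂ h0₂ h1₂]
    at heq
  have e1 := chebyshev (ν := volume.restrict (Ioc (0 : ℝ) 1)) (level_antitone (φ := φ₁))
    (level_antitone (φ := φ₂)) integrable_level integrable_level integrable_level_mul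
  have e2 : ∫ t in Ioc (0 : ℝ) 1, level φ₁ t * level φ₂ t ≤ ∫ t in Ioc (0 : ℝ) 1, level φ t :=
    integral_mono integrable_level_mul integrable_level (level_mul_le hm h)
  refine ⟨?_, chebyshev_eq level_antitone level_antitone integrable_level integrable_level
    integrable_level_mul (e2.trans heq) fun a b => volume_restrict_Ioo_pos⟩
  have e3 := (integral_eq_iff_of_ae_le (μ := volume.restrict (Ioc (0 : ℝ) 1))
    (integrable_level_mul (φ₁ := φ₁) (φ₂ := φ₂)) (integrable_level (φ := φ))
    (ae_of_all _ (level_mul_le hm h))).1 (le_antisymm e2 (heq.trans e1))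
  exact e3

lemma exists_level_pos (hm : Measurable φ) (h0 : ∀ r, 0 ≤ φ r) (h1 : ∀ r, φ r ≤ 1)
    (hpos : 0 < ∫ r, φ r ∂expo) : ∃ T, 0 < T ∧ T ≤ 1 ∧ ∀ t ≤ T, 0 < level φ t := by
  rw [integral_eq_level hm h0 h1] at hpos
  obtain ⟨T, hT, hl⟩ : ∃ T ∈ Ioc (0 : ℝ) 1, level φ T ≠ 0 := by
    by_contra! hcon
    rw [setIntegral_congr_fun measurableSet_Ioc (g := fun _ => 0) hcon] at hpos
    simp at hpos
  exact ⟨T, hT.1, hT.2, fun t ht =>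
    ((level_nonneg T).lt_of_ne' hl).trans_le (level_antitone ht)⟩

/-- If the measure of the level sets of `φ₁` is constant in the equality case, then `φ₁` is
the indicator function of a half-line. -/
lemma exists_threshold (hm : Measurable φ)
    (hm₁ : Measurable φ₁) (h0₁ : ∀ r, 0 ≤ φ₁ r) (h1₁ : ∀ r, φ₁ r ≤ 1)
    (hm₂ : Measurable φ₂) (h0₂ : ∀ r, 0 ≤ φ₂ r) (h1₂ : ∀ r, φ₂ r ≤ 1)
    (h : ∀ r₁ r₂, 0 < r₁ → 0 < r₂ → min (φ₁ r₁) (φ₂ r₂) ≤ φ (r₁ + r₂))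
    (hlev : ∀ᵐ t ∂(volume.restrict (Ioc (0 : ℝ) 1)), level φ₁ t * level φ₂ t = level φ t)
    (hconst : ∀ s ∈ Ioo (0 : ℝ) 1, ∀ t ∈ Ioo (0 : ℝ) 1, level φ₁ s = level φ₁ t)
    (hpos₁ : 0 < ∫ r, φ₁ r ∂expo) (hpos₂ : 0 < ∫ r, φ₂ r ∂expo) :
    ∃ N, 0 ≤ N ∧ (∀ a, 0 < a → a < N → φ₁ a = 0) ∧ (∀ᵐ r ∂expo, N < r → φ₁ r = 1) := by
  obtain ⟨T₁, hT₁, hT₁', hl₁⟩ := exists_level_pos hm₁ h0₁ h1₁ hpos₁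
  obtain ⟨T₂, hT₂, hT₂', hl₂⟩ := exists_level_pos hm₂ h0₂ h1₂ hpos₂
  set κ := level φ₁ 2⁻¹ with hκ
  have hκc : ∀ t ∈ Ioo (0 : ℝ) 1, level φ₁ t = κ := fun t ht =>
    hconst t ht _ ⟨by norm_num, by norm_num⟩
  have hκpos : 0 < κ := by
    rw [← hκc (T₁ / 2) ⟨by linarith, by linarith⟩]; exact hl₁ _ (by linarith)
  -- At a level t where equality holds and `level φ₂ t` can be cancelled, the left end N satisfies
  -- e^{-N} = κ. So it equals -log κ, independently of t, and such t exist arbitrarily close to 0.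
  have hend : ∀ T, 0 < T → ∃ t, 0 < t ∧ t < T ∧ t < 1 ∧
      ∀ a, 0 < a → t ≤ φ₁ a → - Real.log κ ≤ a := by
    intro T hT
    have hp := volume_restrict_Ioo_pos (a := 0) (b := min T T₂) le_rfl (lt_min hT hT₂)
      ((min_le_right _ _).trans hT₂')
    obtain ⟨t, ht, hte⟩ : ∃ t ∈ Ioo 0 (min T T₂), level φ₁ t * level φ₂ t = level φ t := by
      by_contra! hcon
      exact hp.ne' (measure_mono_null hcon (ae_iff.1 hlev))
    have htT : t < T := ht.2.trans_le (min_le_left _ _)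
    have htT2 : t < T₂ := ht.2.trans_le (min_le_right _ _)
    have ht1 := hκc t ⟨ht.1, htT2.trans_le hT₂'⟩
    obtain ⟨N, hN, hNa, e1, e2⟩ := exists_left_end (φ₂ := φ₂) hm h (t := t)
      (by rw [ht1]; exact hκpos.ne')
    rw [← hte] at e1
    have e3 := le_of_mul_le_mul_right e1 (hl₂ t htT2.le)
    have e4 : κ = Real.exp (-N) := by rw [← ht1]; exact le_antisymm e2 e3
    refine ⟨t, ht.1, htT, htT2.trans_le hT₂', fun a ha hta => ?_⟩
    rw [e4, Real.log_exp, neg_neg]; exact hNa a ha hta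
  have hN0 : 0 ≤ - Real.log κ := by
    rw [neg_nonneg]; exact Real.log_nonpos hκpos.le (level_le_one _)
  have hzero : ∀ a, 0 < a → a < - Real.log κ → φ₁ a = 0 := by
    intro a ha haN
    by_contra hne
    obtain ⟨t, -, ht2, -, ht3⟩ := hend (φ₁ a) ((h0₁ a).lt_of_ne' hne)
    exact absurd (ht3 a ha ht2.le) (not_le.2 haN)
  refine ⟨- Real.log κ, hN0, hzero, ?_⟩
  have hae : ∀ t ∈ Ioo (0 : ℝ) 1, ∀ᵐ r ∂expo, - Real.log κ < r → t ≤ φ₁ r := by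
    intro t ht
    -- The superlevel set lies in the half-line up to a null set and has the same measure κ, so the
    -- two agree almost everywhere.
    have hs : {r | t ≤ φ₁ r} =ᵐ[expo] Ioi (- Real.log κ) := by
      refine ae_eq_of_ae_subset_of_measure_ge ?_ ?_ (hm₁ measurableSet_Ici).nullMeasurableSet
        (measure_ne_top _ _)
      · filter_upwards [ae_expo_pos, Measure.ae_ne expo (- Real.log κ)] with r hr hr2 hr3
        refine lt_of_not_ge fun hle => ?_
        have h3 : t ≤ φ₁ r := hr3
        rw [hzero r hr (lt_of_le_of_ne hle hr2)] at h3
        exact absurd ht.1 (not_lt.2 h3)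
      · rw [← ENNReal.toReal_le_toReal (measure_ne_top _ _) (measure_ne_top _ _)]
        change expo.real _ ≤ level φ₁ t
        rw [expo_real_Ioi hN0, hκc t ht, neg_neg, Real.exp_log hκpos]
    filter_upwards [Filter.eventuallyEq_set.1 hs] with r hr hr2 using hr.2 hr2
  -- Countably many levels increasing to 1; the shift by 2 keeps each of them strictly between 0 and
  -- 1.
  have hall := ae_all_iff.2 fun n : ℕ => hae (1 - 1 / ((n : ℝ) + 2)) ⟨by
    rw [sub_pos, div_lt_one (by positivity)]; linarith [(Nat.cast_nonneg n : (0 : ℝ) ≤ n)], by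
    have : (0 : ℝ) < 1 / ((n : ℝ) + 2) := by positivity
    linarith⟩
  filter_upwards [hall] with r hr hr2
  refine le_antisymm (h1₁ r) (le_of_forall_pos_le_add fun ε hε => ?_)
  obtain ⟨n, hn⟩ := exists_nat_one_div_lt hε
  have a1 := hr n hr2
  have a2 : 1 / ((n : ℝ) + 2) ≤ 1 / ((n : ℝ) + 1) := by gcongr; norm_num
  linarith

end Level

/-! ### Equality in the one-dimensional inequality. -/

section Equality

variable {φ φ₁ φ₂ : ℝ → ℝ}

lemma min_le_rpow_mul_rpow {u v a b : ℝ} (hu : 0 ≤ u) (hv : 0 ≤ v) (ha : 0 ≤ a) (hb : 0 ≤ b)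
    (hab : a + b = 1) : min u v ≤ u ^ a * v ^ b := by
  have hm : 0 ≤ min u v := le_min hu hv
  calc min u v = min u v ^ a * min u v ^ b := by
        rw [← Real.rpow_add_of_nonneg hm ha hb, hab, Real.rpow_one]
    _ ≤ u ^ a * v ^ b := by
        gcongr
        · exact min_le_left _ _
        · exact min_le_right _ _

lemma min_le_of_rpow (h0₁ : ∀ r, 0 ≤ φ₁ r) (h0₂ : ∀ r, 0 ≤ φ₂ r)
    (hpow : ∀ r₁ r₂, 0 < r₁ → 0 < r₂ →
      φ₁ r₁ ^ (r₁ / (r₁ + r₂)) * φ₂ r₂ ^ (r₂ / (r₁ + r₂)) ≤ φ (r₁ + r₂)) (r₁ r₂ : ℝ)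
    (hr₁ : 0 < r₁) (hr₂ : 0 < r₂) : min (φ₁ r₁) (φ₂ r₂) ≤ φ (r₁ + r₂) :=
  (min_le_rpow_mul_rpow (h0₁ _) (h0₂ _) (by positivity) (by positivity)
    (by field_simp)).trans (hpow r₁ r₂ hr₁ hr₂)

lemma integral_expo_Ioi {N : ℝ} (hN : 0 ≤ N) (hz : ∀ a, 0 < a → a < N → φ a = 0)
    (h1 : ∀ᵐ r ∂expo, N < r → φ r = 1) : ∫ r, φ r ∂expo = Real.exp (-N) := by
  rw [← expo_real_Ioi hN, ← integral_indicator_one measurableSet_Ioi]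
  refine integral_congr_ae ?_
  filter_upwards [ae_expo_pos, Measure.ae_ne expo N, h1] with r hr hne hr1
  rcases lt_or_gt_of_ne hne with h | h
  · rw [hz r hr h, indicator_of_notMem (by simpa using h.le)]
  · rw [hr1 h, indicator_of_mem (by simpa using h)]; rfl

lemma integral_expo_shift {a : ℝ} (ha : 0 ≤ a) {ψ : ℝ → ℝ} (hm : Measurable φ)
    (h0 : ∀ r, 0 ≤ φ r) (h1 : ∀ r, φ r ≤ 1) (hψ0 : ∀ r, 0 ≤ ψ r)
    (h : ∀ r, 0 < r → ψ r ≤ φ (a + r)) :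
    Real.exp (-a) * ∫ r, ψ r ∂expo ≤ ∫ r, φ r ∂expo := by
  have key := lintegral_expo_shift ha (φ := fun r => ENNReal.ofReal (φ r)) (by fun_prop)
  have i2 : Integrable (fun r => φ (a + r)) expo :=
    integrable_expo (by fun_prop) (fun r => h0 _) (fun r => h1 _)
  have e1 : ∫ r, ψ r ∂expo ≤ ∫ r, φ (a + r) ∂expo :=
    integral_mono_of_nonneg (ae_of_all _ hψ0) i2
      (by filter_upwards [ae_expo_pos] with r hr using h r hr)
  rw [← ofReal_integral_eq_lintegral_ofReal i2 (ae_of_all _ fun r => h0 _),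
    ← ofReal_integral_eq_lintegral_ofReal (integrable_expo hm h0 h1) (ae_of_all _ h0),
    ← ENNReal.ofReal_mul (Real.exp_pos _).le,
    ENNReal.ofReal_le_ofReal_iff (integral_nonneg h0)] at key
  exact (mul_le_mul_of_nonneg_left e1 (Real.exp_pos _).le).trans key

/-- If, in the equality case, `φ₁` is the indicator function of `(N, ∞)` with `N > 0`, then
`φ₂` takes only the values `0` and `1`. -/
lemma ae_eq_zero_or_one (hm : Measurable φ) (h0 : ∀ r, 0 ≤ φ r) (h1 : ∀ r, φ r ≤ 1)
    (hm₂ : Measurable φ₂) (h0₂ : ∀ r, 0 ≤ φ₂ r) (h1₂ : ∀ r, φ₂ r ≤ 1)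
    (hpow : ∀ r₁ r₂, 0 < r₁ → 0 < r₂ →
      φ₁ r₁ ^ (r₁ / (r₁ + r₂)) * φ₂ r₂ ^ (r₂ / (r₁ + r₂)) ≤ φ (r₁ + r₂))
    (heq : ∫ r, φ r ∂expo ≤ (∫ r, φ₁ r ∂expo) * (∫ r, φ₂ r ∂expo))
    {N : ℝ} (hN : 0 < N) (hz : ∀ a, 0 < a → a < N → φ₁ a = 0)
    (hone : ∀ᵐ r ∂expo, N < r → φ₁ r = 1) :
    ∀ᵐ r ∂expo, φ₂ r = 0 ∨ φ₂ r = 1 := by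
  -- The exponent r/(N + r) is the limit, as a decreases to N, of the weight of φ₂ r in the
  -- log-concavity bound when φ₁ a = 1. The truncation `max r 0` keeps it in [0, 1] for all real r.
  -- Since ψ exceeds φ₂ strictly wherever 0 < φ₂ < 1 and r > 0, equality of integrals will exclude
  -- such values.
  set ψ : ℝ → ℝ := fun r => φ₂ r ^ (max r 0 / (N + max r 0)) with hψ
  have hψm : Measurable ψ := by fun_prop
  have hψ0 : ∀ r, 0 ≤ ψ r := fun r => Real.rpow_nonneg (h0₂ r) _
  have hψ1 : ∀ r, ψ r ≤ 1 := fun r => Real.rpow_le_one (h0₂ r) (h1₂ r) (by positivity)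
  have hle : ∀ r, φ₂ r ≤ ψ r := by
    intro r
    calc φ₂ r = φ₂ r ^ (1 : ℝ) := (Real.rpow_one _).symm
      _ ≤ ψ r := Real.rpow_le_rpow_of_exponent_ge' (h0₂ r) (h1₂ r) (by positivity)
        (by rw [div_le_one (by positivity)]; linarith)
  rw [integral_expo_Ioi hN.le hz hone] at heq
  have hshift : Real.exp (-N) * ∫ r, ψ r ∂expo ≤ ∫ r, φ r ∂expo := by
    by_contra! hcon
    -- The value of φ₁ at N itself is unknown, so the shift uses some a slightly above N with φ₁ a =
    -- 1 and continuity in a.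
    have hc : ContinuousAt (fun a => Real.exp (-a) * ∫ r, ψ r ∂expo) N := by fun_prop
    obtain ⟨δ, hδ, hball⟩ := Metric.eventually_nhds_iff.1 (hc.eventually (lt_mem_nhds hcon))
    obtain ⟨a, ha, ha1'⟩ := exists_mem_Ioo_of_ae_expo hone hN.le (lt_add_of_pos_right N hδ)
    have ha1 : φ₁ a = 1 := ha1' ha.1
    refine absurd (hball (y := a) (by
      rw [Real.dist_eq, abs_of_pos (sub_pos.2 ha.1)]; linarith [ha.2])) (not_lt.2 ?_)
    refine integral_expo_shift (hN.trans ha.1).le hm h0 h1 hψ0 fun r hr => ?_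
    have h3 := hpow a r (hN.trans ha.1) hr
    rw [ha1, Real.one_rpow, one_mul] at h3
    refine le_trans ?_ h3
    simp only [hψ, max_eq_left hr.le]
    have hNa := ha.1
    refine Real.rpow_le_rpow_of_exponent_ge' (h0₂ r) (h1₂ r) ?_ ?_
    · have : 0 < a := hN.trans ha.1
      positivity
    · gcongr
  have hint : ∫ r, ψ r ∂expo ≤ ∫ r, φ₂ r ∂expo :=
    le_of_mul_le_mul_left (hshift.trans heq) (Real.exp_pos _)
  have iψ := integrable_expo hψm hψ0 hψ1
  have i₂ := integrable_expo hm₂ h0₂ h1₂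
  have hae := (integral_eq_iff_of_ae_le i₂ iψ (ae_of_all _ hle)).1
    (le_antisymm (integral_mono i₂ iψ hle) hint)
  filter_upwards [hae, ae_expo_pos] with r hr hr0
  by_contra! hcon
  have hlt : φ₂ r ^ (1 : ℝ) < ψ r :=
    Real.rpow_lt_rpow_of_exponent_gt ((h0₂ r).lt_of_ne' hcon.1) ((h1₂ r).lt_of_ne hcon.2) (by
      rw [max_eq_left hr0.le, div_lt_one (by positivity)]; linarith)
  rw [Real.rpow_one, ← hr] at hlt
  exact lt_irrefl _ hlt

lemma level_const_of_ae_eq_zero_or_one (h : ∀ᵐ r ∂expo, φ r = 0 ∨ φ r = 1) :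
    ∀ s ∈ Ioo (0 : ℝ) 1, ∀ t ∈ Ioo (0 : ℝ) 1, level φ s = level φ t := by
  have key : ∀ s ∈ Ioo (0 : ℝ) 1, level φ s = expo.real {r | φ r = 1} := by
    intro s hs
    refine measureReal_congr (Filter.eventuallyEq_set.2 ?_)
    filter_upwards [h] with r hr
    rcases hr with hr | hr
    · rw [hr]; simpa using hs.1
    · rw [hr]; simpa using hs.2.le
  intro s hs t ht
  rw [key s hs, key t ht]

/-- Any r > N₁ + N₂ is a sum of two radii above the respective thresholds, chosen off the null sets.
This gives the value at every such r, not only at almost every one. -/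
lemma eq_one_of_thresholds (h1 : ∀ r, φ r ≤ 1) (h0₁ : ∀ r, 0 ≤ φ₁ r) (h0₂ : ∀ r, 0 ≤ φ₂ r)
    (hpow : ∀ r₁ r₂, 0 < r₁ → 0 < r₂ →
      φ₁ r₁ ^ (r₁ / (r₁ + r₂)) * φ₂ r₂ ^ (r₂ / (r₁ + r₂)) ≤ φ (r₁ + r₂))
    {N₁ N₂ : ℝ} (hN₁ : 0 ≤ N₁) (hN₂ : 0 ≤ N₂) (ho₁ : ∀ᵐ r ∂expo, N₁ < r → φ₁ r = 1)
    (ho₂ : ∀ᵐ r ∂expo, N₂ < r → φ₂ r = 1) (r : ℝ) (hr : N₁ + N₂ < r) : φ r = 1 := by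
  rw [ae_expo_iff] at ho₁ ho₂
  have ho₂' : ∀ᵐ a ∂(volume : Measure ℝ), 0 < r - a → N₂ < r - a → φ₂ (r - a) = 1 :=
    (quasiMeasurePreserving_sub_left volume r).ae ho₂
  obtain ⟨a, ha, e1, e2⟩ : ∃ a ∈ Ioo N₁ (r - N₂), φ₁ a = 1 ∧ φ₂ (r - a) = 1 := by
    by_contra! hno
    have h2 : ∀ᵐ a ∂(volume : Measure ℝ), a ∉ Ioo N₁ (r - N₂) := by
      filter_upwards [ho₁, ho₂'] with a ha hb ha'
      have := ha'.1
      have := ha'.2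
      exact hno a ha' (ha (by linarith) ha'.1) (hb (by linarith) (by linarith))
    rw [← measure_eq_zero_iff_ae_notMem, Real.volume_Ioo] at h2
    simp at h2
    linarith
  have hb1 := ha.1
  have hb2 := ha.2
  have h3 := min_le_of_rpow h0₁ h0₂ hpow a (r - a) (by linarith) (by linarith)
  rw [e1, e2, min_self, add_sub_cancel] at h3
  exact le_antisymm (h1 r) h3

/-- The equality case of `integral_mul_integral_le`. -/
theorem exists_thresholds (hm : Measurable φ) (h0 : ∀ r, 0 ≤ φ r) (h1 : ∀ r, φ r ≤ 1)
    (hm₁ : Measurable φ₁) (h0₁ : ∀ r, 0 ≤ φ₁ r) (h1₁ : ∀ r, φ₁ r ≤ 1)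
    (hm₂ : Measurable φ₂) (h0₂ : ∀ r, 0 ≤ φ₂ r) (h1₂ : ∀ r, φ₂ r ≤ 1)
    (hpow : ∀ r₁ r₂, 0 < r₁ → 0 < r₂ →
      φ₁ r₁ ^ (r₁ / (r₁ + r₂)) * φ₂ r₂ ^ (r₂ / (r₁ + r₂)) ≤ φ (r₁ + r₂))
    (heq : ∫ r, φ r ∂expo ≤ (∫ r, φ₁ r ∂expo) * (∫ r, φ₂ r ∂expo))
    (hpos₁ : 0 < ∫ r, φ₁ r ∂expo) (hpos₂ : 0 < ∫ r, φ₂ r ∂expo)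
    (hn₁ : ¬ ∀ᵐ r ∂expo, φ₁ r = 1) (hn₂ : ¬ ∀ᵐ r ∂expo, φ₂ r = 1) :
    ∃ N₁ N₂, 0 < N₁ ∧ 0 < N₂ ∧ (∀ᵐ r ∂expo, N₁ < r → φ₁ r = 1) ∧
      (∀ᵐ r ∂expo, N₂ < r → φ₂ r = 1) ∧ (∀ r, N₁ + N₂ < r → φ r = 1) ∧
      (∀ᵐ r ∂expo, r < N₁ + N₂ → φ r = 0) := by
  have hmin := min_le_of_rpow h0₁ h0₂ hpow
  have hpow' : ∀ r₂ r₁, 0 < r₂ → 0 < r₁ →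
      φ₂ r₂ ^ (r₂ / (r₂ + r₁)) * φ₁ r₁ ^ (r₁ / (r₂ + r₁)) ≤ φ (r₂ + r₁) := by
    intro r₂ r₁ hr₂ hr₁
    rw [add_comm r₂ r₁, mul_comm]; exact hpow r₁ r₂ hr₁ hr₂
  have hmin' := min_le_of_rpow h0₂ h0₁ hpow'
  obtain ⟨hlev, hconst⟩ := integral_mul_integral_eq hm h0 h1 hm₁ h0₁ h1₁ hm₂ h0₂ h1₂ hmin heq
  have hlev' : ∀ᵐ t ∂(volume.restrict (Ioc (0 : ℝ) 1)), level φ₂ t * level φ₁ t = level φ t := by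
    filter_upwards [hlev] with t ht
    rw [mul_comm, ht]
  have pos_of : ∀ {χ : ℝ → ℝ} {N : ℝ}, ¬ (∀ᵐ r ∂expo, χ r = 1) → 0 ≤ N →
      (∀ᵐ r ∂expo, N < r → χ r = 1) → 0 < N := by
    intro χ N hn hN ho
    refine hN.lt_of_ne' fun h => hn ?_
    filter_upwards [ho, ae_expo_pos] with r hr hr0 using hr (h ▸ hr0)
  obtain ⟨N₁, N₂, hN₁, hN₂, hz₁, hz₂, ho₁, ho₂⟩ : ∃ N₁ N₂, 0 < N₁ ∧ 0 < N₂ ∧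
      (∀ a, 0 < a → a < N₁ → φ₁ a = 0) ∧ (∀ a, 0 < a → a < N₂ → φ₂ a = 0) ∧
      (∀ᵐ r ∂expo, N₁ < r → φ₁ r = 1) ∧ (∀ᵐ r ∂expo, N₂ < r → φ₂ r = 1) := by
    -- Whichever level function is constant yields a threshold for its ray; that makes the other
    -- function 0/1-valued, hence its level function constant as well, and then it too has a
    -- threshold.
    rcases hconst with hc | hc
    · obtain ⟨N₁, hN₁, hz₁, ho₁⟩ := exists_threshold hm hm₁ h0₁ h1₁ hm₂ h0₂ h1₂ hmin hlev hc
        hpos₁ hpos₂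
      have hc₂ := level_const_of_ae_eq_zero_or_one (ae_eq_zero_or_one hm h0 h1 hm₂ h0₂ h1₂ hpow heq
        (pos_of hn₁ hN₁ ho₁) hz₁ ho₁)
      obtain ⟨N₂, hN₂, hz₂, ho₂⟩ := exists_threshold hm hm₂ h0₂ h1₂ hm₁ h0₁ h1₁ hmin' hlev' hc₂
        hpos₂ hpos₁
      exact ⟨N₁, N₂, pos_of hn₁ hN₁ ho₁, pos_of hn₂ hN₂ ho₂, hz₁, hz₂, ho₁, ho₂⟩
    · obtain ⟨N₂, hN₂, hz₂, ho₂⟩ := exists_threshold hm hm₂ h0₂ h1₂ hm₁ h0₁ h1₁ hmin' hlev' hc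
        hpos₂ hpos₁
      have hc₁ := level_const_of_ae_eq_zero_or_one (ae_eq_zero_or_one hm h0 h1 hm₁ h0₁ h1₁ hpow'
        (by rwa [mul_comm]) (pos_of hn₂ hN₂ ho₂) hz₂ ho₂)
      obtain ⟨N₁, hN₁, hz₁, ho₁⟩ := exists_threshold hm hm₁ h0₁ h1₁ hm₂ h0₂ h1₂ hmin hlev hc₁
        hpos₁ hpos₂
      exact ⟨N₁, N₂, pos_of hn₁ hN₁ ho₁, pos_of hn₂ hN₂ ho₂, hz₁, hz₂, ho₁, ho₂⟩
  have hone := eq_one_of_thresholds h1 h0₁ h0₂ hpow hN₁.le hN₂.le ho₁ ho₂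
  -- It remains to see that φ vanishes below N₁ + N₂: φ dominates the indicator of (N₁ + N₂, ∞), and
  -- its integral is at most e^{-N₁} e^{-N₂}, the integral of that indicator.
  refine ⟨N₁, N₂, hN₁, hN₂, ho₁, ho₂, hone, ?_⟩
  rw [integral_expo_Ioi hN₁.le hz₁ ho₁, integral_expo_Ioi hN₂.le hz₂ ho₂, ← Real.exp_add,
    ← neg_add, ← expo_real_Ioi (add_pos hN₁ hN₂).le, ← integral_indicator_one measurableSet_Ioi]
    at heq
  have hle : ∀ r, (Ioi (N₁ + N₂)).indicator (1 : ℝ → ℝ) r ≤ φ r := by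
    intro r
    by_cases hr : r ∈ Ioi (N₁ + N₂)
    · rw [indicator_of_mem hr, hone r hr]; rfl
    · rw [indicator_of_notMem hr]; exact h0 r
  have i1 : Integrable ((Ioi (N₁ + N₂)).indicator (1 : ℝ → ℝ)) expo :=
    (integrable_indicator_iff measurableSet_Ioi).2 (integrable_const _).integrableOn
  have i2 := integrable_expo hm h0 h1
  have hae := (integral_eq_iff_of_ae_le i1 i2 (ae_of_all _ hle)).1
    (le_antisymm (integral_mono i1 i2 hle) heq)
  filter_upwards [hae] with r hr hlt
  rw [← hr, indicator_of_notMem (by simpa using hlt.le)]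

end Equality

/-! ### Lebesgue measure on coordinate subspaces. -/

section SectionMeasure

variable {n : ℕ}

/-- `embed τ` as a linear map. -/
def embedLin (τ : Finset (Fin n)) : (τ → ℝ) →ₗ[ℝ] (Fin n → ℝ) where
  toFun := embed τ
  map_add' x y := by
    ext i; by_cases h : i ∈ τ <;> simp [embed, h]
  map_smul' c x := by
    ext i; by_cases h : i ∈ τ <;> simp [embed, h]

lemma embed_smul (τ : Finset (Fin n)) (c : ℝ) (y : τ → ℝ) : embed τ (c • y) = c • embed τ y :=
  (embedLin τ).map_smul c y

lemma embed_zero (τ : Finset (Fin n)) : embed τ 0 = 0 := (embedLin τ).map_zero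

lemma continuous_embed (τ : Finset (Fin n)) : Continuous (embed τ) :=
  (embedLin τ).continuous_of_finiteDimensional

lemma embed_apply_mem {τ : Finset (Fin n)} (y : τ → ℝ) {i : Fin n} (hi : i ∈ τ) :
    embed τ y i = y ⟨i, hi⟩ := dif_pos hi

lemma embed_apply_notMem {τ : Finset (Fin n)} (y : τ → ℝ) {i : Fin n} (hi : i ∉ τ) :
    embed τ y i = 0 := dif_neg hi

lemma embed_injective (τ : Finset (Fin n)) : Function.Injective (embed τ) := by
  intro x y h
  ext i
  have := congrFun h i
  rwa [embed_apply_mem _ i.2, embed_apply_mem _ i.2] at this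

lemma measurableEmbedding_embed (τ : Finset (Fin n)) : MeasurableEmbedding (embed τ) :=
  (continuous_embed τ).measurableEmbedding (embed_injective τ)

instance (τ : Finset (Fin n)) : SigmaFinite (sectionMeasure τ) :=
  (measurableEmbedding_embed τ).sigmaFinite_map

/-- The coordinate projection of `ℝⁿ` onto `H_S`. -/
def coordProj (S : Finset (Fin n)) : (Fin n → ℝ) →ₗ[ℝ] (Fin n → ℝ) where
  toFun x i := if i ∈ S then x i else 0
  map_add' x y := by
    ext i; by_cases h : i ∈ S <;> simp [h]
  map_smul' c x := by
    ext i; by_cases h : i ∈ S <;> simp [h]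

lemma coordProj_apply (S : Finset (Fin n)) (x : Fin n → ℝ) (i : Fin n) :
    coordProj S x i = if i ∈ S then x i else 0 := rfl

lemma embed_restrict (S : Finset (Fin n)) (x : Fin n → ℝ) :
    embed S (fun i => x i) = coordProj S x := by
  ext i; by_cases h : i ∈ S <;> simp [embed, coordProj_apply, h]

lemma ae_sectionMeasure_iff {τ : Finset (Fin n)} {p : (Fin n → ℝ) → Prop} :
    (∀ᵐ x ∂(sectionMeasure τ), p x) ↔ ∀ᵐ y : τ → ℝ, p (embed τ y) :=
  (measurableEmbedding_embed τ).ae_map_iff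

lemma lintegral_sectionMeasure (τ : Finset (Fin n)) (F : (Fin n → ℝ) → ℝ≥0∞) :
    ∫⁻ x, F x ∂(sectionMeasure τ) = ∫⁻ y : τ → ℝ, F (embed τ y) :=
  (measurableEmbedding_embed τ).lintegral_map F

lemma ae_sectionMeasure_apply_eq_zero (τ : Finset (Fin n)) :
    ∀ᵐ x ∂(sectionMeasure τ), ∀ i ∉ τ, x i = 0 :=
  ae_sectionMeasure_iff.2 (ae_of_all _ fun y _ hi => embed_apply_notMem y hi)

lemma sectionMeasure_univ : sectionMeasure (Finset.univ : Finset (Fin n)) = volume := by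
  rw [volume_pi]
  refine (Measure.pi_eq fun s hs => ?_).symm
  rw [sectionMeasure, (measurableEmbedding_embed _).map_apply]
  have h : embed (Finset.univ : Finset (Fin n)) ⁻¹' univ.pi s =
      univ.pi fun i : (Finset.univ : Finset (Fin n)) => s i := by
    ext y
    simp only [mem_preimage, mem_univ_pi]
    constructor
    · intro h i
      have := h i
      rwa [embed_apply_mem _ (Finset.mem_univ _)] at this
    · intro h i
      rw [embed_apply_mem _ (Finset.mem_univ _)]
      exact h ⟨i, Finset.mem_univ _⟩
  rw [h, volume_pi_pi]
  exact Finset.prod_coe_sort Finset.univ fun i => volume (s i)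

lemma sectionMeasure_empty : sectionMeasure (∅ : Finset (Fin n)) = Measure.dirac 0 := by
  rw [sectionMeasure, volume_pi, Measure.pi_of_empty _ 0,
    Measure.map_dirac' (measurableEmbedding_embed _).measurable, embed_zero]

lemma sectionMeasure_union {S T : Finset (Fin n)} (h : Disjoint S T) :
    sectionMeasure (S ∪ T) =
      ((sectionMeasure S).prod (sectionMeasure T)).map fun p => p.1 + p.2 := by
  have hm : ∀ U : Finset (Fin n), Measurable (embed U) := fun U =>
    (measurableEmbedding_embed U).measurable
  rw [sectionMeasure, ← (volume_preserving_piFinsetUnion (fun _ : Fin n => ℝ) h).map_eq,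
    Measure.map_map (hm _) (MeasurableEquiv.measurable _), sectionMeasure, sectionMeasure,
    Measure.map_prod_map _ _ (hm S) (hm T), Measure.map_map (by fun_prop) ((hm S).prodMap (hm T))]
  congr 1
  ext p i
  have hd : ∀ i, i ∈ S → i ∉ T := fun i hi => Finset.disjoint_left.1 h hi
  by_cases hS : i ∈ S
  · have e := Equiv.piFinsetUnion_left (fun _ : Fin n => ℝ) h (f := p.1) (g := p.2) hS
      (Finset.mem_union_left _ hS)
    simp only [Function.comp, Prod.map, Pi.add_apply, embed, hS, hd i hS, Finset.mem_union,
      true_or, dite_true, dite_false, add_zero]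
    exact e
  · by_cases hT : i ∈ T
    · have e := Equiv.piFinsetUnion_right (fun _ : Fin n => ℝ) h (f := p.1) (g := p.2) hT
        (Finset.mem_union_right _ hT)
      simp only [Function.comp, Prod.map, Pi.add_apply, embed, hS, hT, Finset.mem_union,
        or_true, dite_true, dite_false, zero_add]
      exact e
    · simp [embed, hS, hT]

lemma lintegral_sectionMeasure_smul (S : Finset (Fin n)) (F : (Fin n → ℝ) → ℝ≥0∞) {r : ℝ}
    (hr : 0 < r) :
    ∫⁻ x, F (r⁻¹ • x) ∂(sectionMeasure S) =
      ENNReal.ofReal (r ^ S.card) * ∫⁻ x, F x ∂(sectionMeasure S) := by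
  have hr' : r⁻¹ ≠ 0 := inv_ne_zero hr.ne'
  have he : MeasurableEmbedding fun y : S → ℝ => r⁻¹ • y :=
    (Homeomorph.smulOfNeZero r⁻¹ hr').measurableEmbedding
  rw [lintegral_sectionMeasure, lintegral_sectionMeasure]
  simp_rw [← embed_smul]
  rw [← he.lintegral_map fun y => F (embed S y), Measure.map_addHaar_smul _ hr',
    lintegral_smul_measure]
  simp [abs_of_pos hr]

lemma sectionMeasure_preimage_smul (S : Finset (Fin n)) {r : ℝ} (hr : 0 < r)
    (Z : Set (Fin n → ℝ)) :
    sectionMeasure S ((fun x => r⁻¹ • x) ⁻¹' Z) =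
      ENNReal.ofReal (r ^ S.card) * sectionMeasure S Z := by
  have hr' : r⁻¹ ≠ 0 := inv_ne_zero hr.ne'
  rw [sectionMeasure, (measurableEmbedding_embed _).map_apply,
    (measurableEmbedding_embed _).map_apply]
  have : embed S ⁻¹' ((fun x => r⁻¹ • x) ⁻¹' Z) = (fun x => r⁻¹ • x) ⁻¹' (embed S ⁻¹' Z) := by
    ext y; simp [embed_smul]
  rw [this, Measure.addHaar_preimage_smul _ hr']
  simp [abs_of_pos hr]

/-- Log-concave functions are only almost everywhere measurable, so composition with (x, r) ↦ x/r
requires null sets to pull back to null sets. -/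
lemma quasiMeasurePreserving_smul (S : Finset (Fin n)) :
    Measure.QuasiMeasurePreserving (fun p : (Fin n → ℝ) × ℝ => p.2⁻¹ • p.1)
      ((sectionMeasure S).prod expo) (sectionMeasure S) := by
  have hm : Measurable fun p : (Fin n → ℝ) × ℝ => p.2⁻¹ • p.1 :=
    measurable_snd.inv.smul measurable_fst
  refine ⟨hm, Measure.AbsolutelyContinuous.mk fun Z hZ h0 => ?_⟩
  rw [Measure.map_apply hm hZ, Measure.prod_apply_symm (hm hZ)]
  refine lintegral_eq_zero_of_ae_eq_zero ?_
  filter_upwards [ae_expo_pos] with r hr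
  change sectionMeasure S ((fun x => r⁻¹ • x) ⁻¹' Z) = 0
  rw [sectionMeasure_preimage_smul S hr, h0, mul_zero]

end SectionMeasure

/-! ### Log-concave functions and their measurability. -/

section LogConcave

variable {n : ℕ} {f : (Fin n → ℝ) → ℝ}

lemma IsLogConcave.min_le (hf : IsLogConcave f) (x y : Fin n → ℝ) {a b : ℝ} (ha : 0 ≤ a)
    (hb : 0 ≤ b) (hab : a + b = 1) : min (f x) (f y) ≤ f (a • x + b • y) :=
  (min_le_rpow_mul_rpow (hf.1 x) (hf.1 y) ha hb hab).trans (hf.2 x y a b ha hb hab)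

lemma IsLogConcave.convex_superlevel (hf : IsLogConcave f) (t : ℝ) : Convex ℝ {x | t ≤ f x} := by
  intro x hx y hy a b ha hb hab
  exact (le_min hx hy).trans (hf.min_le x y ha hb hab)

lemma IsLogConcave.convex_support (hf : IsLogConcave f) : Convex ℝ {x | 0 < f x} := by
  intro x hx y hy a b ha hb hab
  exact (lt_min hx hy).trans_le (hf.min_le x y ha hb hab)

/-- Superlevel sets are convex, hence meet a line in intervals; this gives genuine measurability
along every ray. -/
lemma IsLogConcave.measurable_ray (hf : IsLogConcave f) (x : Fin n → ℝ) :
    Measurable fun r : ℝ => f (r⁻¹ • x) := by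
  have h : Measurable fun s : ℝ => f (s • x) := by
    refine measurable_of_Ici fun t => (Convex.ordConnected ?_).measurableSet
    exact (hf.convex_superlevel t).is_linear_preimage
      (f := fun s : ℝ => s • x) (LinearMap.toSpanSingleton ℝ _ x).isLinear
  exact h.comp measurable_inv

lemma IsLogConcave.aemeasurable (hf : IsLogConcave f) (S : Finset (Fin n)) :
    AEMeasurable f (sectionMeasure S) := by
  refine (measurableEmbedding_embed S).aemeasurable_map_iff.2 ?_
  refine NullMeasurable.aemeasurable ?_
  have h : ∀ t, NullMeasurableSet (embed S ⁻¹' {x | t ≤ f x}) volume := fun t =>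
    Convex.nullMeasurableSet volume
      ((hf.convex_superlevel t).is_linear_preimage (embedLin S).isLinear)
  exact measurable_of_Ici (α := ℝ) (δ := NullMeasurableSpace (S → ℝ) volume) h

lemma IsLogConcave.rpow_mul_le (hf : IsLogConcave f) (x y : Fin n → ℝ) (r₁ r₂ : ℝ) (h₁ : 0 < r₁)
    (h₂ : 0 < r₂) :
    f (r₁⁻¹ • x) ^ (r₁ / (r₁ + r₂)) * f (r₂⁻¹ • y) ^ (r₂ / (r₁ + r₂)) ≤
      f ((r₁ + r₂)⁻¹ • (x + y)) := by
  have h := hf.2 (r₁⁻¹ • x) (r₂⁻¹ • y) (r₁ / (r₁ + r₂)) (r₂ / (r₁ + r₂)) (by positivity)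
    (by positivity) (by field_simp)
  refine h.trans_eq (congrArg f ?_)
  rw [smul_smul, smul_smul, smul_add]
  congr 2 <;> field_simp

lemma IsLogConcave.div (hf : IsLogConcave f) {M : ℝ} (hM : 0 < M) :
    IsLogConcave fun x => f x / M := by
  refine ⟨fun x => div_nonneg (hf.1 x) hM.le, fun x y a b ha hb hab => ?_⟩
  rw [Real.div_rpow (hf.1 x) hM.le, Real.div_rpow (hf.1 y) hM.le, div_mul_div_comm,
    ← Real.rpow_add hM, hab, Real.rpow_one]
  exact div_le_div_of_nonneg_right (hf.2 x y a b ha hb hab) hM.le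

lemma IsLogConcave.min_one (hf : IsLogConcave f) : IsLogConcave fun x => min (f x) 1 := by
  have h0 : ∀ x, 0 ≤ min (f x) 1 := fun x => le_min (hf.1 x) zero_le_one
  refine ⟨h0, fun x y a b ha hb hab => le_min ?_ ?_⟩
  · refine le_trans ?_ (hf.2 x y a b ha hb hab)
    exact mul_le_mul (Real.rpow_le_rpow (h0 x) (min_le_left _ _) ha)
      (Real.rpow_le_rpow (h0 y) (min_le_left _ _) hb) (Real.rpow_nonneg (h0 y) _)
      (Real.rpow_nonneg (hf.1 x) _)
  · exact mul_le_one₀ (Real.rpow_le_one (h0 x) (min_le_right _ _) ha) (Real.rpow_nonneg (h0 y) _)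
      (Real.rpow_le_one (h0 y) (min_le_right _ _) hb)

lemma isLogConcave_indicator {C : Set (Fin n → ℝ)} (hC : Convex ℝ C) :
    IsLogConcave (C.indicator fun _ => 1) := by
  have h0 : ∀ x, 0 ≤ C.indicator (fun _ => (1 : ℝ)) x := fun x =>
    indicator_nonneg (fun _ _ => zero_le_one) x
  have h1 : ∀ x, C.indicator (fun _ => (1 : ℝ)) x ≤ 1 := fun x =>
    indicator_le_self' (fun _ _ => zero_le_one) x
  refine ⟨h0, fun x y a b ha hb hab => ?_⟩
  by_cases hz : a • x + b • y ∈ C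
  · rw [indicator_of_mem hz]
    exact mul_le_one₀ (Real.rpow_le_one (h0 x) (h1 x) ha) (Real.rpow_nonneg (h0 y) _)
      (Real.rpow_le_one (h0 y) (h1 y) hb)
  · rw [indicator_of_notMem hz]
    by_cases hx : x ∈ C
    · by_cases hy : y ∈ C
      · exact absurd (hC hx hy ha hb hab) hz
      · have hb0 : b ≠ 0 := by
          rintro rfl
          obtain rfl : a = 1 := by linarith
          simp [hx] at hz
        simp [hy, Real.zero_rpow hb0]
    · have ha0 : a ≠ 0 ∨ (a = 0 ∧ b = 1) := by
        by_cases h : a = 0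
        · right; exact ⟨h, by linarith⟩
        · exact Or.inl h
      rcases ha0 with h | ⟨rfl, rfl⟩
      · simp [hx, Real.zero_rpow h]
      · have hy : y ∉ C := by simpa using hz
        simp [hy]

end LogConcave

/-! ### Ray averages and supermultiplicativity of the weight. -/

/-- The average of `f` over the points `x / r`, where `r` is exponentially distributed. -/
noncomputable def rayIntegral {n : ℕ} (f : (Fin n → ℝ) → ℝ) (x : Fin n → ℝ) : ℝ≥0∞ :=
  ∫⁻ r, ENNReal.ofReal (f (r⁻¹ • x)) ∂expo

/-- `|S|! ∫_{H_S} f`. -/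
noncomputable def weight {n : ℕ} (f : (Fin n → ℝ) → ℝ) (S : Finset (Fin n)) : ℝ≥0∞ :=
  S.card.factorial * ∫⁻ x, ENNReal.ofReal (f x) ∂(sectionMeasure S)

section Weight

variable {n : ℕ} {f : (Fin n → ℝ) → ℝ} {S T : Finset (Fin n)}

lemma aemeasurable_uncurry_smul {g : (Fin n → ℝ) → ℝ≥0∞} (hg : AEMeasurable g (sectionMeasure S)) :
    AEMeasurable (Function.uncurry fun (x : Fin n → ℝ) (r : ℝ) => g (r⁻¹ • x))
      ((sectionMeasure S).prod expo) :=
  hg.comp_quasiMeasurePreserving (quasiMeasurePreserving_smul S)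

lemma aemeasurable_lintegral_smul {g : (Fin n → ℝ) → ℝ≥0∞}
    (hg : AEMeasurable g (sectionMeasure S)) :
    AEMeasurable (fun x => ∫⁻ r, g (r⁻¹ • x) ∂expo) (sectionMeasure S) :=
  (aemeasurable_uncurry_smul hg).lintegral_prod_right'

/-- Exchange the integrals: dilation by r multiplies the integral over H_S by r^{|S|}, whose
exponential mean is |S|!. -/
lemma factorial_mul_lintegral {g : (Fin n → ℝ) → ℝ≥0∞} (hg : AEMeasurable g (sectionMeasure S)) :
    S.card.factorial * ∫⁻ x, g x ∂(sectionMeasure S) =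
      ∫⁻ x, ∫⁻ r, g (r⁻¹ • x) ∂expo ∂(sectionMeasure S) := by
  rw [lintegral_lintegral_swap (aemeasurable_uncurry_smul hg), ← lintegral_expo_pow,
    ← lintegral_mul_const _ (by fun_prop)]
  refine lintegral_congr_ae ?_
  filter_upwards [ae_expo_pos] with r hr
  exact (lintegral_sectionMeasure_smul S g hr).symm

lemma IsLogConcave.aemeasurable_rayIntegral (hf : IsLogConcave f) (S : Finset (Fin n)) :
    AEMeasurable (rayIntegral f) (sectionMeasure S) :=
  aemeasurable_lintegral_smul (hf.aemeasurable S).ennreal_ofReal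

lemma IsLogConcave.weight_eq (hf : IsLogConcave f) (S : Finset (Fin n)) :
    weight f S = ∫⁻ x, rayIntegral f x ∂(sectionMeasure S) :=
  factorial_mul_lintegral (hf.aemeasurable S).ennreal_ofReal

lemma IsLogConcave.rayIntegral_eq (hf : IsLogConcave f) (h1 : ∀ x, f x ≤ 1) (x : Fin n → ℝ) :
    rayIntegral f x = ENNReal.ofReal (∫ r, f (r⁻¹ • x) ∂expo) :=
  (ofReal_integral_eq_lintegral_ofReal
    (integrable_expo (hf.measurable_ray x) (fun _ => hf.1 _) fun _ => h1 _)
    (ae_of_all _ fun _ => hf.1 _)).symm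

lemma IsLogConcave.rayIntegral_mul_le (hf : IsLogConcave f) (h1 : ∀ x, f x ≤ 1)
    (x y : Fin n → ℝ) : rayIntegral f x * rayIntegral f y ≤ rayIntegral f (x + y) := by
  rw [hf.rayIntegral_eq h1, hf.rayIntegral_eq h1, hf.rayIntegral_eq h1,
    ← ENNReal.ofReal_mul (integral_nonneg fun _ => hf.1 _)]
  refine ENNReal.ofReal_le_ofReal (integral_mul_integral_le
    (hf.measurable_ray _) (fun _ => hf.1 _) (fun _ => h1 _) (hf.measurable_ray _) (fun _ => hf.1 _)
    (fun _ => h1 _) (hf.measurable_ray _) (fun _ => hf.1 _) (fun _ => h1 _)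
    (min_le_of_rpow (φ := fun r => f (r⁻¹ • (x + y))) (φ₁ := fun r => f (r⁻¹ • x))
      (φ₂ := fun r => f (r⁻¹ • y))
      (fun _ => hf.1 _) (fun _ => hf.1 _) (hf.rpow_mul_le x y)))

lemma lintegral_sectionMeasure_union (h : Disjoint S T) {G : (Fin n → ℝ) → ℝ≥0∞}
    (hG : AEMeasurable G (sectionMeasure (S ∪ T))) :
    ∫⁻ x, G x ∂(sectionMeasure (S ∪ T)) =
      ∫⁻ p, G (p.1 + p.2) ∂((sectionMeasure S).prod (sectionMeasure T)) := by
  rw [sectionMeasure_union h] at hG ⊢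
  exact lintegral_map' hG (by fun_prop)

lemma IsLogConcave.weight_mul_eq (hf : IsLogConcave f) (S T : Finset (Fin n)) :
    weight f S * weight f T =
      ∫⁻ p, rayIntegral f p.1 * rayIntegral f p.2
        ∂((sectionMeasure S).prod (sectionMeasure T)) := by
  rw [hf.weight_eq, hf.weight_eq,
    lintegral_prod_mul (hf.aemeasurable_rayIntegral S) (hf.aemeasurable_rayIntegral T)]

/-- The inequality for a decomposition of a coordinate subspace into two. -/
lemma IsLogConcave.weight_mul_le (hf : IsLogConcave f) (h1 : ∀ x, f x ≤ 1) (h : Disjoint S T) :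
    weight f S * weight f T ≤ weight f (S ∪ T) := by
  rw [hf.weight_mul_eq, hf.weight_eq,
    lintegral_sectionMeasure_union h (hf.aemeasurable_rayIntegral _)]
  exact lintegral_mono fun p => hf.rayIntegral_mul_le h1 _ _

lemma IsLogConcave.ae_rayIntegral_eq (hf : IsLogConcave f) (h1 : ∀ x, f x ≤ 1)
    (h : Disjoint S T) (hle : weight f (S ∪ T) ≤ weight f S * weight f T)
    (htop : weight f (S ∪ T) ≠ ⊤) :
    ∀ᵐ p ∂((sectionMeasure S).prod (sectionMeasure T)),
      rayIntegral f p.1 * rayIntegral f p.2 = rayIntegral f (p.1 + p.2) := by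
  have htop' := ((hf.weight_mul_le h1 h).trans_lt htop.lt_top).ne
  have hm : AEMeasurable (fun p : (Fin n → ℝ) × (Fin n → ℝ) => rayIntegral f (p.1 + p.2))
      ((sectionMeasure S).prod (sectionMeasure T)) := by
    have hG := hf.aemeasurable_rayIntegral (S ∪ T)
    rw [sectionMeasure_union h] at hG
    exact hG.comp_measurable (by fun_prop)
  rw [hf.weight_mul_eq] at hle htop'
  rw [hf.weight_eq, lintegral_sectionMeasure_union h (hf.aemeasurable_rayIntegral _)] at hle
  exact ae_eq_of_ae_le_of_lintegral_le (ae_of_all _ fun p => hf.rayIntegral_mul_le h1 _ _)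
    htop' hm hle

/-- Excludes the degenerate threshold N = 0. The set Z of rays on which f is almost everywhere 1 has
finite measure by Markov's inequality, yet it contains 2Z, whose measure is 2^{|S|} times as large;
hence Z is null. -/
lemma ae_not_ray_eq_one (hf : IsLogConcave f) (hS : S.Nonempty) (htop : weight f S ≠ ⊤) :
    ∀ᵐ x ∂(sectionMeasure S), ¬ ∀ᵐ r ∂expo, f (r⁻¹ • x) = 1 := by
  set Z : Set (Fin n → ℝ) := {x | ∀ᵐ r ∂expo, f (r⁻¹ • x) = 1} with hZ
  suffices h : sectionMeasure S Z = 0 from measure_eq_zero_iff_ae_notMem.1 h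
  have hfin : sectionMeasure S Z ≠ ⊤ := by
    have hsub : Z ⊆ {x | 1 ≤ rayIntegral f x} := by
      intro x hx
      have : rayIntegral f x = ∫⁻ _, 1 ∂expo := by
        refine lintegral_congr_ae ?_
        filter_upwards [show ∀ᵐ r ∂expo, f (r⁻¹ • x) = 1 from hx] with r hr
        rw [hr, ENNReal.ofReal_one]
      change 1 ≤ rayIntegral f x
      rw [this]; simp
    have h2 := mul_meas_ge_le_lintegral₀ (hf.aemeasurable_rayIntegral S) 1
    rw [one_mul, ← hf.weight_eq] at h2
    exact ((measure_mono hsub).trans h2).trans_lt htop.lt_top |>.ne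
  have hsub : (fun x : Fin n → ℝ => (2 : ℝ)⁻¹ • x) ⁻¹' Z ⊆ Z := by
    intro x hx
    have hx' : ∀ᵐ r ∂expo, f (r⁻¹ • (2 : ℝ)⁻¹ • x) = 1 := hx
    change ∀ᵐ r ∂expo, f (r⁻¹ • x) = 1
    rw [ae_expo_iff, ae_iff] at hx' ⊢
    have h3 := Measure.addHaar_preimage_smul (volume : Measure ℝ) (r := 2⁻¹) (by norm_num)
      {r : ℝ | ¬ (0 < r → f (r⁻¹ • (2 : ℝ)⁻¹ • x) = 1)}
    rw [hx', mul_zero] at h3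
    refine measure_mono_null ?_ h3
    intro r hr hr2
    refine hr fun hr0 => ?_
    have h4 := hr2 (by simpa using hr0)
    have h5 : (2⁻¹ * r)⁻¹ * 2⁻¹ = r⁻¹ := by field_simp
    rw [smul_smul] at h4
    exact h5 ▸ h4
  have h5 := measure_mono (μ := sectionMeasure S) hsub
  rw [sectionMeasure_preimage_smul S (by norm_num)] at h5
  by_contra hne
  have h6 : ENNReal.ofReal (2 ^ S.card) ≤ 1 := by
    rw [← ENNReal.mul_le_mul_iff_left hne hfin, one_mul]
    exact h5
  rw [ENNReal.ofReal_le_one] at h6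
  have h7 : (1 : ℝ) < 2 ^ S.card := one_lt_pow₀ (by norm_num) (Finset.card_pos.2 hS).ne'
  linarith

/-- The structure of `f` along almost every pair of rays in the equality case. -/
lemma IsLogConcave.ae_thresholds (hf : IsLogConcave f) (h1 : ∀ x, f x ≤ 1)
    (h : Disjoint S T) (hS : S.Nonempty) (hT : T.Nonempty)
    (hle : weight f (S ∪ T) ≤ weight f S * weight f T)
    (htop : weight f (S ∪ T) ≠ ⊤) (hpos : weight f (S ∪ T) ≠ 0) :
    ∀ᵐ p ∂((sectionMeasure S).prod (sectionMeasure T)),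
      rayIntegral f (p.1 + p.2) ≠ 0 →
      ∃ N₁ N₂, 0 < N₁ ∧ 0 < N₂ ∧ (∀ᵐ r ∂expo, N₁ < r → f (r⁻¹ • p.1) = 1) ∧
        (∀ᵐ r ∂expo, N₂ < r → f (r⁻¹ • p.2) = 1) ∧
        (∀ r, N₁ + N₂ < r → f (r⁻¹ • (p.1 + p.2)) = 1) ∧
        (∀ᵐ r ∂expo, r < N₁ + N₂ → f (r⁻¹ • (p.1 + p.2)) = 0) := by
  have hprod := ((hf.weight_mul_le h1 h).trans_lt htop.lt_top).ne
  have hne : weight f S * weight f T ≠ 0 := fun h0 => hpos (le_antisymm (h0 ▸ hle) (zero_le))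
  have htS : weight f S ≠ ⊤ := fun ht => by
    rw [ht, ENNReal.top_mul (right_ne_zero_of_mul hne)] at hprod; exact hprod rfl
  have htT : weight f T ≠ ⊤ := fun ht => by
    rw [ht, ENNReal.mul_top (left_ne_zero_of_mul hne)] at hprod; exact hprod rfl
  have aS := Measure.quasiMeasurePreserving_fst (μ := sectionMeasure S) (ν := sectionMeasure T)
    |>.ae (ae_not_ray_eq_one hf hS htS)
  have aT := Measure.quasiMeasurePreserving_snd (μ := sectionMeasure S) (ν := sectionMeasure T)
    |>.ae (ae_not_ray_eq_one hf hT htT)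
  filter_upwards [hf.ae_rayIntegral_eq h1 h hle htop, aS, aT] with p hp hpS hpT hp0
  rw [← hp, hf.rayIntegral_eq h1, hf.rayIntegral_eq h1] at hp0
  have q1 := ENNReal.ofReal_pos.1 (pos_iff_ne_zero.2 (left_ne_zero_of_mul hp0))
  have q2 := ENNReal.ofReal_pos.1 (pos_iff_ne_zero.2 (right_ne_zero_of_mul hp0))
  rw [hf.rayIntegral_eq h1, hf.rayIntegral_eq h1, hf.rayIntegral_eq h1,
    ← ENNReal.ofReal_mul q1.le] at hp
  have hle' := (ENNReal.ofReal_le_ofReal_iff (mul_pos q1 q2).le).1 hp.ge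
  exact exists_thresholds (φ := fun r => f (r⁻¹ • (p.1 + p.2))) (φ₁ := fun r => f (r⁻¹ • p.1))
    (φ₂ := fun r => f (r⁻¹ • p.2)) (hf.measurable_ray _) (fun _ => hf.1 _) (fun _ => h1 _)
    (hf.measurable_ray _) (fun _ => hf.1 _) (fun _ => h1 _) (hf.measurable_ray _)
    (fun _ => hf.1 _) (fun _ => h1 _) (hf.rpow_mul_le _ _) hle' q1 q2 hpS hpT

end Weight

/-! ### Boundedness from finite measure or finite integral. -/

section ConvexMeasure

variable {E : Type*} [NormedAddCommGroup E] [NormedSpace ℝ E] [MeasurableSpace E] [BorelSpace E]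
  (μ : Measure E) [μ.IsAddHaarMeasure] {A : Set E}

lemma interior_nonempty_of_measure_ne_zero [FiniteDimensional ℝ E] (hA : Convex ℝ A) (h : μ A ≠ 0) :
    (interior A).Nonempty := by
  rw [hA.interior_nonempty_iff_affineSpan_eq_top]
  by_contra hne
  exact h (measure_mono_null (subset_affineSpan ℝ A) (Measure.addHaar_affineSubspace μ _ hne))

/-- A convex set of finite measure with nonempty interior is bounded. -/
lemma isBounded_of_measure_ne_top (hA : Convex ℝ A) (hi : (interior A).Nonempty)
    (h : μ A ≠ ⊤) : Bornology.IsBounded A := by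
  obtain ⟨z, hz⟩ := hi
  obtain ⟨ρ, hρ, hball⟩ := Metric.mem_nhds_iff.1 (mem_interior_iff_mem_nhds.1 hz)
  have hv : μ (Metric.ball 0 (ρ / 2)) ≠ 0 := (Metric.measure_ball_pos μ _ (by positivity)).ne'
  obtain ⟨K, hK⟩ := ENNReal.exists_nat_mul_gt hv h
  have hK0 : 0 < K := Nat.pos_of_ne_zero fun h0 => by simp [h0] at hK
  have hK0' : (0 : ℝ) < K := Nat.cast_pos.2 hK0
  refine (Metric.isBounded_ball (x := z) (r := 2 * K * ρ)).subset fun p hp => ?_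
  rw [Metric.mem_ball, dist_eq_norm]
  by_contra! hfar
  -- K centres on the first half of the segment from z to p. Convexity puts balls of radius ρ/2
  -- around them inside A, and ‖p - z‖ ≥ 2Kρ makes these disjoint; their total measure exceeds that
  -- of A by the choice of K.
  set c : ℕ → E := fun k => z + ((k : ℝ) / (2 * K)) • (p - z) with hc
  have hsub : ∀ k ∈ Finset.range K, Metric.ball (c k) (ρ / 2) ⊆ A := by
    intro k hk q hq
    rw [Metric.mem_ball, dist_eq_norm] at hq
    have hkK : (k : ℝ) ≤ K := Nat.cast_le.2 (Finset.mem_range.1 hk).le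
    set l : ℝ := (k : ℝ) / (2 * K) with hl
    have hl0 : 0 ≤ l := by positivity
    have hl2 : l ≤ 1 / 2 := by rw [hl, div_le_div_iff₀ (by positivity) (by norm_num)]; linarith
    have hl1 : 0 < 1 - l := by linarith
    have hmem : z + (1 - l)⁻¹ • (q - c k) ∈ A := by
      refine hball ?_
      rw [Metric.mem_ball, dist_eq_norm, add_sub_cancel_left, norm_smul, Real.norm_eq_abs,
        abs_of_pos (inv_pos.2 hl1), inv_mul_lt_iff₀ hl1]
      nlinarith
    have := hA hmem hp hl1.le hl0 (by ring)
    convert this using 1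
    rw [smul_add, smul_smul, mul_inv_cancel₀ hl1.ne', one_smul, hc]
    simp only [← hl]
    module
  have hdisj : (↑(Finset.range K) : Set ℕ).PairwiseDisjoint fun k => Metric.ball (c k) (ρ / 2) := by
    intro k _ l _ hkl
    refine Metric.ball_disjoint_ball ?_
    have hd : c k - c l = (((k : ℝ) - l) / (2 * K)) • (p - z) := by
      simp only [hc]; module
    have hkl1 : (1 : ℝ) ≤ |(k : ℝ) - l| := by
      have : (1 : ℤ) ≤ |(k : ℤ) - l| := Int.one_le_abs (by omega)
      exact_mod_cast this
    rw [dist_eq_norm, hd, norm_smul, Real.norm_eq_abs, abs_div,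
      abs_of_pos (by positivity : (0 : ℝ) < 2 * K),
      add_halves, div_mul_eq_mul_div, le_div_iff₀ (by positivity)]
    nlinarith [norm_nonneg (p - z)]
  have hsum := measure_biUnion_finset (μ := μ) hdisj fun k _ => Metric.isOpen_ball.measurableSet
  simp only [Measure.addHaar_ball_center, Finset.sum_const, Finset.card_range, nsmul_eq_mul] at hsum
  have hle : μ (⋃ k ∈ Finset.range K, Metric.ball (c k) (ρ / 2)) ≤ μ A :=
    measure_mono (iUnion₂_subset hsub)
  rw [hsum] at hle
  exact absurd hK (not_lt.2 hle)

end ConvexMeasure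

section Bounded

variable {n : ℕ} {f : (Fin n → ℝ) → ℝ}

/-- A log-concave function with finite nonzero integral is bounded. -/
lemma IsLogConcave.bddAbove (hf : IsLogConcave f) (h0 : ∫⁻ x, ENNReal.ofReal (f x) ≠ 0)
    (htop : ∫⁻ x, ENNReal.ofReal (f x) ≠ ⊤) : ∃ M, ∀ x, f x ≤ M := by
  obtain ⟨k, hk⟩ : ∃ k : ℕ, volume {x | 1 / ((k : ℝ) + 1) ≤ f x} ≠ 0 := by
    by_contra! hcon
    refine h0 (lintegral_eq_zero_of_ae_eq_zero ?_)
    have : ∀ᵐ x : Fin n → ℝ, ∀ k : ℕ, ¬ 1 / ((k : ℝ) + 1) ≤ f x :=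
      ae_all_iff.2 fun k => measure_eq_zero_iff_ae_notMem.1 (hcon k)
    filter_upwards [this] with x hx
    refine ENNReal.ofReal_eq_zero.2 (le_of_not_gt fun hpos => ?_)
    obtain ⟨k, hk⟩ := exists_nat_one_div_lt hpos
    exact hx k hk.le
  set t : ℝ := 1 / ((k : ℝ) + 1) with ht
  have htpos : 0 < t := by positivity
  obtain ⟨z, hz⟩ := interior_nonempty_of_measure_ne_zero volume (hf.convex_superlevel t) hk
  obtain ⟨ρ, hρ, hball⟩ := Metric.mem_nhds_iff.1 (mem_interior_iff_mem_nhds.1 hz)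
  set v := volume (Metric.ball (0 : Fin n → ℝ) (ρ / 2)) with hv
  have hv0 : v ≠ 0 := (Metric.measure_ball_pos volume _ (by positivity)).ne'
  have hvt : v ≠ ⊤ := measure_ball_lt_top.ne
  set I := ∫⁻ x, ENNReal.ofReal (f x) with hI
  refine ⟨((I / v).toReal) ^ 2 / t, fun p => ?_⟩
  -- Each q near the midpoint of p and z is itself the midpoint of p and a point of the ball where f
  -- ≥ t. So a large value at p forces a large integral over a ball of fixed size.
  have hlow : ∀ q ∈ Metric.ball ((1 / 2 : ℝ) • p + (1 / 2 : ℝ) • z) (ρ / 2),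
      Real.sqrt (f p * t) ≤ f q := by
    intro q hq
    have hm : (2 : ℝ) • q - p ∈ Metric.ball z ρ := by
      rw [Metric.mem_ball, dist_eq_norm] at hq ⊢
      have e : (2 : ℝ) • q - p - z = (2 : ℝ) • (q - ((1 / 2 : ℝ) • p + (1 / 2 : ℝ) • z)) := by
        module
      rw [e, norm_smul, Real.norm_eq_abs, abs_of_pos two_pos]
      linarith
    have h1 : t ≤ f ((2 : ℝ) • q - p) := hball hm
    have h2 := hf.2 p ((2 : ℝ) • q - p) (1 / 2) (1 / 2) (by norm_num) (by norm_num) (by norm_num)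
    have e : (1 / 2 : ℝ) • p + (1 / 2 : ℝ) • ((2 : ℝ) • q - p) = q := by module
    rw [e] at h2
    refine le_trans ?_ h2
    rw [Real.sqrt_eq_rpow, Real.mul_rpow (hf.1 p) htpos.le]
    have := hf.1 p
    gcongr
  have hint : ENNReal.ofReal (Real.sqrt (f p * t)) * v ≤ I := by
    calc ENNReal.ofReal (Real.sqrt (f p * t)) * v
        = ∫⁻ _ in Metric.ball ((1 / 2 : ℝ) • p + (1 / 2 : ℝ) • z) (ρ / 2),
            ENNReal.ofReal (Real.sqrt (f p * t)) := by
          rw [setLIntegral_const, Measure.addHaar_ball_center]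
      _ ≤ ∫⁻ x in Metric.ball ((1 / 2 : ℝ) • p + (1 / 2 : ℝ) • z) (ρ / 2), ENNReal.ofReal (f x) :=
          setLIntegral_mono' Metric.isOpen_ball.measurableSet fun q hq =>
            ENNReal.ofReal_le_ofReal (hlow q hq)
      _ ≤ I := setLIntegral_le_lintegral _ _
  have hdiv : ENNReal.ofReal (Real.sqrt (f p * t)) ≤ I / v :=
    (ENNReal.le_div_iff_mul_le (Or.inl hv0) (Or.inl hvt)).2 hint
  have hs := (ENNReal.ofReal_le_iff_le_toReal (ENNReal.div_ne_top htop hv0)).1 hdiv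
  rw [le_div_iff₀ htpos]
  exact (Real.sqrt_le_left ENNReal.toReal_nonneg).1 hs

end Bounded

/-! ### Structure of f in the equality case for two complementary subspaces. -/

/-- Every point of `C` is a convex combination of a point of `C ∩ H_S` and one of `C ∩ H_{Sᶜ}`. -/
def SplitsAlong {n : ℕ} (S : Finset (Fin n)) (C : Set (Fin n → ℝ)) : Prop :=
  ∀ z ∈ C, ∃ a ∈ Icc (0 : ℝ) 1, ∃ c ∈ C, ∃ d ∈ C,
    coordProj S z = a • c ∧ coordProj Sᶜ z = (1 - a) • d

/-- The closure of the support of `f`. -/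
def closedSupport {n : ℕ} (f : (Fin n → ℝ) → ℝ) : Set (Fin n → ℝ) := closure {x | 0 < f x}

section Structure

variable {n : ℕ} {f : (Fin n → ℝ) → ℝ} {S : Finset (Fin n)}

/-- The admissible pairs of projections form a continuous image of a compact set. Closedness lets
the splitting pass from a dense set of points to all of the closed support. -/
lemma isClosed_splitting {C : Set (Fin n → ℝ)} (hC : IsCompact C) (S : Finset (Fin n)) :
    IsClosed {z | ∃ a ∈ Icc (0 : ℝ) 1, ∃ c ∈ C, ∃ d ∈ C,
      coordProj S z = a • c ∧ coordProj Sᶜ z = (1 - a) • d} := by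
  have hK : IsCompact
      ((fun p : ℝ × (Fin n → ℝ) × (Fin n → ℝ) => (p.1 • p.2.1, (1 - p.1) • p.2.2)) ''
      (Icc (0 : ℝ) 1 ×ˢ (C ×ˢ C))) :=
    (isCompact_Icc.prod (hC.prod hC)).image (by fun_prop)
  have hc : Continuous fun z : Fin n → ℝ => (coordProj S z, coordProj Sᶜ z) :=
    ((coordProj S).continuous_of_finiteDimensional).prodMk
      ((coordProj Sᶜ).continuous_of_finiteDimensional)
  convert hK.isClosed.preimage hc using 1
  ext z
  constructor
  · rintro ⟨a, ha, c, hc, d, hd, e1, e2⟩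
    exact ⟨(a, c, d), ⟨ha, hc, hd⟩, Prod.ext e1.symm e2.symm⟩
  · rintro ⟨⟨a, c, d⟩, ⟨ha, hc, hd⟩, e⟩
    exact ⟨a, ha, c, hc, d, hd, (congrArg Prod.fst e).symm, (congrArg Prod.snd e).symm⟩

lemma coordProj_eq_self {x : Fin n → ℝ} (hx : ∀ i ∉ S, x i = 0) : coordProj S x = x := by
  ext i; by_cases h : i ∈ S <;> simp [coordProj_apply, h, hx]

lemma coordProj_eq_zero {x : Fin n → ℝ} (hx : ∀ i ∈ S, x i = 0) : coordProj S x = 0 := by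
  ext i; by_cases h : i ∈ S <;> simp [coordProj_apply, h, hx]

lemma coordProj_add_compl (S : Finset (Fin n)) (x : Fin n → ℝ) :
    coordProj S x + coordProj Sᶜ x = x := by
  ext i; by_cases h : i ∈ S <;> simp [coordProj_apply, h]

lemma weight_univ : weight f Finset.univ = n.factorial * ∫⁻ x, ENNReal.ofReal (f x) := by
  rw [weight, sectionMeasure_univ, Finset.card_univ, Fintype.card_fin]

lemma volume_support_ne_zero (hw : weight f Finset.univ ≠ 0) :
    volume {x | 0 < f x} ≠ 0 := by
  intro h0
  refine hw ?_
  rw [weight_univ, lintegral_eq_zero_of_ae_eq_zero, mul_zero]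
  filter_upwards [measure_eq_zero_iff_ae_notMem.1 h0] with x hx
  exact ENNReal.ofReal_eq_zero.2 (not_lt.1 hx)

lemma volume_support_ne_top (hf : IsLogConcave f) (h01 : ∀ᵐ x, f x = 0 ∨ f x = 1)
    (hw : weight f Finset.univ ≠ ⊤) : volume {x | 0 < f x} ≠ ⊤ := by
  have hfin : ∫⁻ x, ENNReal.ofReal (f x) ≠ ⊤ := fun ht => by
    rw [weight_univ, ht, ENNReal.mul_top (by simp [Nat.factorial_ne_zero])] at hw
    exact hw rfl
  refine (lt_of_le_of_lt ?_ hfin.lt_top).ne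
  rw [← lintegral_indicator_one₀ (hf.convex_support.nullMeasurableSet volume)]
  refine lintegral_mono_ae ?_
  filter_upwards [h01] with x hx
  by_cases hp : x ∈ {x | 0 < f x}
  · have hp' : 0 < f x := hp
    rw [indicator_of_mem hp, hx.resolve_left hp'.ne']
    simp
  · rw [indicator_of_notMem hp]; exact zero_le

/-- In the equality case, `f` takes only the values `0` and `1`. -/
lemma IsLogConcave.ae_eq_zero_or_one (hf : IsLogConcave f) (h1 : ∀ x, f x ≤ 1)
    (hS : S.Nonempty) (hSc : Sᶜ.Nonempty)
    (hle : weight f Finset.univ ≤ weight f S * weight f Sᶜ)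
    (htop : weight f Finset.univ ≠ ⊤) (hpos : weight f Finset.univ ≠ 0) :
    ∀ᵐ x, f x = 0 ∨ f x = 1 := by
  have hd : Disjoint S Sᶜ := disjoint_compl_right
  have hu : S ∪ Sᶜ = Finset.univ := Finset.union_compl S
  have hth := hf.ae_thresholds h1 hd hS hSc (by rwa [hu]) (by rwa [hu]) (by rwa [hu])
  have hg : AEMeasurable (fun x => ENNReal.ofReal (f x * (1 - f x))) (sectionMeasure (S ∪ Sᶜ)) :=
    ((hf.aemeasurable _).mul ((hf.aemeasurable _).const_sub 1)).ennreal_ofReal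
  -- The ray formula applied to f(1 - f): along almost every ray f is almost everywhere 0 or
  -- exhibits the jump from 0 to 1, so f(1 - f) vanishes there.
  have hzero : ∫⁻ x, ENNReal.ofReal (f x * (1 - f x)) ∂(sectionMeasure (S ∪ Sᶜ)) = 0 := by
    have key := factorial_mul_lintegral hg
    rw [lintegral_sectionMeasure_union hd (aemeasurable_lintegral_smul hg)] at key
    refine (mul_eq_zero.1 (key.trans ?_)).resolve_left (by simp [Nat.factorial_ne_zero])
    refine lintegral_eq_zero_of_ae_eq_zero ?_
    filter_upwards [hth] with p hp
    refine lintegral_eq_zero_of_ae_eq_zero ?_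
    by_cases h0 : rayIntegral f (p.1 + p.2) = 0
    · rw [rayIntegral, lintegral_eq_zero_iff (hf.measurable_ray _).ennreal_ofReal] at h0
      filter_upwards [h0] with r hr
      have : f (r⁻¹ • (p.1 + p.2)) = 0 := le_antisymm (ENNReal.ofReal_eq_zero.1 hr) (hf.1 _)
      simp [this, -smul_add]
    · obtain ⟨N₁, N₂, -, -, -, -, e1, e2⟩ := hp h0
      filter_upwards [e2, Measure.ae_ne expo (N₁ + N₂)] with r hr hne
      rcases lt_or_gt_of_ne hne with h | h
      · simp [hr h, -smul_add]
      · simp [e1 r h, -smul_add]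
  rw [lintegral_eq_zero_iff' hg, hu, sectionMeasure_univ] at hzero
  filter_upwards [hzero] with x hx
  have h3 := ENNReal.ofReal_eq_zero.1 hx
  have h4 : f x * (1 - f x) = 0 := le_antisymm h3 (mul_nonneg (hf.1 x) (by linarith [h1 x]))
  rcases mul_eq_zero.1 h4 with h | h
  · exact Or.inl h
  · right; linarith

lemma inv_smul_mem_closure {x : Fin n → ℝ} {A : Set (Fin n → ℝ)} {N : ℝ} (hN : 0 < N)
    (h : ∀ᵐ r ∂expo, N < r → r⁻¹ • x ∈ A) : N⁻¹ • x ∈ closure A := by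
  rw [mem_closure_iff]
  intro o ho hx
  have hc : ContinuousAt (fun r : ℝ => r⁻¹ • x) N := by fun_prop (disch := exact hN.ne')
  obtain ⟨δ, hδ, hball⟩ := Metric.eventually_nhds_iff.1 (hc.eventually (ho.mem_nhds hx))
  obtain ⟨r, hr, hrA⟩ := exists_mem_Ioo_of_ae_expo h hN.le (lt_add_of_pos_right N hδ)
  exact ⟨r⁻¹ • x, hball (by rw [Real.dist_eq, abs_of_pos (sub_pos.2 hr.1)]; linarith [hr.2]),
    hrA hr.1⟩

lemma zero_mem_closure {x : Fin n → ℝ} {A : Set (Fin n → ℝ)} {N : ℝ} (hN : 0 < N)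
    (h : ∀ᵐ r ∂expo, N < r → r⁻¹ • x ∈ A) : (0 : Fin n → ℝ) ∈ closure A := by
  have ht : Filter.Tendsto (fun r : ℝ => r⁻¹ • x) Filter.atTop (nhds 0) := by
    simpa using (tendsto_inv_atTop_zero (𝕜 := ℝ)).smul_const x
  refine mem_closure_of_frequently_of_tendsto ?_ ht
  rw [Filter.frequently_atTop]
  intro a
  obtain ⟨r, hr, hrA⟩ := exists_mem_Ioo_of_ae_expo h (hN.le.trans (le_max_right a N))
    (lt_add_one _)
  exact ⟨r, (le_max_left _ _).trans hr.1.le, hrA ((le_max_right _ _).trans_lt hr.1)⟩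

/-- In the equality case, the closed support contains the origin and splits along `S`. -/
lemma IsLogConcave.splitsAlong_closedSupport (hf : IsLogConcave f) (h1 : ∀ x, f x ≤ 1)
    (hS : S.Nonempty) (hSc : Sᶜ.Nonempty)
    (hle : weight f Finset.univ ≤ weight f S * weight f Sᶜ)
    (htop : weight f Finset.univ ≠ ⊤) (hpos : weight f Finset.univ ≠ 0)
    (hcomp : IsCompact (closedSupport f)) :
    0 ∈ closedSupport f ∧ SplitsAlong S (closedSupport f) := by
  have hd : Disjoint S Sᶜ := disjoint_compl_right
  have hu : S ∪ Sᶜ = Finset.univ := Finset.union_compl S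
  have hth := hf.ae_thresholds h1 hd hS hSc (by rwa [hu]) (by rwa [hu]) (by rwa [hu])
  set A : Set (Fin n → ℝ) := {x | 0 < f x} with hA
  have hAc : Convex ℝ A := hf.convex_support
  have hAi : (interior A).Nonempty :=
    interior_nonempty_of_measure_ne_zero volume hAc (volume_support_ne_zero hpos)
  have hC : Convex ℝ (closedSupport f) := hAc.closure
  have haeS := Measure.quasiMeasurePreserving_fst (μ := sectionMeasure S)
    (ν := sectionMeasure Sᶜ) |>.ae (ae_sectionMeasure_apply_eq_zero S)
  have haeT := Measure.quasiMeasurePreserving_snd (μ := sectionMeasure S)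
    (ν := sectionMeasure Sᶜ) |>.ae (ae_sectionMeasure_apply_eq_zero Sᶜ)
  -- The threshold structure holds only for almost every pair, but every nonempty open subset of the
  -- support contains a sum of such a pair.
  have hex : ∀ U : Set (Fin n → ℝ), IsOpen U → U ⊆ A → U.Nonempty →
      0 ∈ closedSupport f ∧ ∃ z ∈ U, ∃ a ∈ Icc (0 : ℝ) 1, ∃ c ∈ closedSupport f,
        ∃ d ∈ closedSupport f, coordProj S z = a • c ∧ coordProj Sᶜ z = (1 - a) • d := by
    intro U hU hUA hUne
    have hUpos : ((sectionMeasure S).prod (sectionMeasure Sᶜ))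
        ((fun p : (Fin n → ℝ) × (Fin n → ℝ) => p.1 + p.2) ⁻¹' U) ≠ 0 := by
      rw [← Measure.map_apply (by fun_prop) hU.measurableSet, ← sectionMeasure_union hd, hu,
        sectionMeasure_univ]
      exact (hU.measure_pos volume hUne).ne'
    obtain ⟨p, hpU, hp, hp1, hp2⟩ : ∃ p : (Fin n → ℝ) × (Fin n → ℝ), p.1 + p.2 ∈ U ∧
        (rayIntegral f (p.1 + p.2) ≠ 0 →
          ∃ N₁ N₂, 0 < N₁ ∧ 0 < N₂ ∧ (∀ᵐ r ∂expo, N₁ < r → f (r⁻¹ • p.1) = 1) ∧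
          (∀ᵐ r ∂expo, N₂ < r → f (r⁻¹ • p.2) = 1) ∧
          (∀ r, N₁ + N₂ < r → f (r⁻¹ • (p.1 + p.2)) = 1) ∧
          (∀ᵐ r ∂expo, r < N₁ + N₂ → f (r⁻¹ • (p.1 + p.2)) = 0)) ∧
        (∀ i ∉ S, p.1 i = 0) ∧ (∀ i ∉ Sᶜ, p.2 i = 0) := by
      by_contra! hno
      refine hUpos (measure_eq_zero_iff_ae_notMem.2 ?_)
      filter_upwards [hth, haeS, haeT] with p a1 a2 a3 hpU
      obtain ⟨i, hi, hne⟩ := hno p hpU a1 a2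
      exact hne (a3 i hi)
    have hc : ContinuousAt (fun r : ℝ => r⁻¹ • (p.1 + p.2)) 1 := by
      fun_prop (disch := exact one_ne_zero)
    obtain ⟨δ, hδ, hball⟩ := Metric.eventually_nhds_iff.1
      (hc.eventually (hU.mem_nhds (by simpa using hpU)))
    have hnear : ∀ {P : ℝ → Prop}, (∀ᵐ r ∂expo, P r) → ∀ b, b < 1 →
        ∃ r, b < r ∧ r < 1 ∧ 0 < f (r⁻¹ • (p.1 + p.2)) ∧ P r := by
      intro P hP b hb
      obtain ⟨r, hr, hrP⟩ := exists_mem_Ioo_of_ae_expo hP (a := max 0 (max b (1 - δ))) (b := 1)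
        (le_max_left _ _) (max_lt one_pos (max_lt hb (by linarith)))
      have hr2 : 1 - δ < r := ((le_max_right _ _).trans (le_max_right _ _)).trans_lt hr.1
      have hr3 : b < r := ((le_max_left _ _).trans (le_max_right _ _)).trans_lt hr.1
      exact ⟨r, hr3, hr.2, hUA (hball (by
        rw [Real.dist_eq, abs_sub_comm, abs_of_pos (sub_pos.2 hr.2)]; linarith)), hrP⟩
    have hray : rayIntegral f (p.1 + p.2) ≠ 0 := by
      intro h0
      rw [rayIntegral, lintegral_eq_zero_iff (hf.measurable_ray _).ennreal_ofReal] at h0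
      obtain ⟨r, -, -, hr, hr0⟩ := hnear h0 0 one_pos
      exact absurd hr (not_lt.2 (ENNReal.ofReal_eq_zero.1 hr0))
    obtain ⟨N₁, N₂, hN₁, hN₂, e1, e2, -, e4⟩ := hp hray
    -- The point p.1 + p.2 lies in an open subset of the support, so f is positive at radii slightly
    -- below 1, and the jump radius cannot exceed 1.
    have hN : N₁ + N₂ ≤ 1 := by
      by_contra! hlt
      obtain ⟨r, -, hr1, hr, hr0⟩ := hnear e4 0 one_pos
      rw [hr0 (hr1.trans hlt)] at hr
      exact lt_irrefl _ hr
    have m1 : ∀ᵐ r ∂expo, N₁ < r → r⁻¹ • p.1 ∈ A := by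
      filter_upwards [e1] with r hr hlt
      change 0 < f _
      rw [hr hlt]; exact one_pos
    have m2 : ∀ᵐ r ∂expo, N₂ < r → r⁻¹ • p.2 ∈ A := by
      filter_upwards [e2] with r hr hlt
      change 0 < f _
      rw [hr hlt]; exact one_pos
    have h0 : 0 ∈ closedSupport f := zero_mem_closure hN₁ m1
    have hN1 : 0 < 1 - N₁ := by linarith
    -- The weight is a = N₁ with c = p.1/N₁. As N₁ + N₂ may be less than 1, the boundary point
    -- p.2/N₂ is shrunk towards 0 so that its coefficient is exactly 1 - N₁.
    refine ⟨h0, p.1 + p.2, hpU, N₁, ⟨hN₁.le, by linarith⟩, N₁⁻¹ • p.1, inv_smul_mem_closure hN₁ m1,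
      (N₂ / (1 - N₁)) • (N₂⁻¹ • p.2), ?_, ?_, ?_⟩
    · exact hC.smul_mem_of_zero_mem h0 (inv_smul_mem_closure hN₂ m2)
        ⟨by positivity, by rw [div_le_one hN1]; linarith⟩
    · rw [map_add, coordProj_eq_self hp1, coordProj_eq_zero (fun i hi => hp2 i (by simpa using hi)),
        add_zero, smul_inv_smul₀ hN₁.ne']
    · rw [map_add, coordProj_eq_self hp2, coordProj_eq_zero (fun i hi => hp1 i (by simpa using hi)),
        zero_add, smul_smul, smul_smul]
      have : (1 - N₁) * (N₂ / (1 - N₁)) * N₂⁻¹ = 1 := by field_simp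
      rw [this, one_smul]
  refine ⟨(hex _ isOpen_interior interior_subset hAi).1, ?_⟩
  have hsub : closedSupport f ⊆ {z | ∃ a ∈ Icc (0 : ℝ) 1, ∃ c ∈ closedSupport f,
      ∃ d ∈ closedSupport f, coordProj S z = a • c ∧ coordProj Sᶜ z = (1 - a) • d} := by
    have hcl := isClosed_splitting hcomp S
    have hce : closedSupport f = closure (interior A) :=
      (hAc.closure_interior_eq_closure_of_nonempty_interior hAi).symm
    refine hce.le.trans (closure_minimal (fun z hz => ?_) hcl)
    rw [← hcl.closure_eq, mem_closure_iff]
    intro o ho hzo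
    obtain ⟨-, w, hw, hw'⟩ := hex (o ∩ interior A) (ho.inter isOpen_interior)
      (inter_subset_right.trans interior_subset) ⟨z, hzo, hz⟩
    exact ⟨w, hw.1, hw'⟩
  exact fun z hz => hsub hz

lemma IsLogConcave.isCompact_closedSupport (hf : IsLogConcave f)
    (h01 : ∀ᵐ x, f x = 0 ∨ f x = 1) (htop : weight f Finset.univ ≠ ⊤)
    (hpos : weight f Finset.univ ≠ 0) : IsCompact (closedSupport f) :=
  (isBounded_of_measure_ne_top volume hf.convex_support
    (interior_nonempty_of_measure_ne_zero volume hf.convex_support (volume_support_ne_zero hpos))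
    (volume_support_ne_top hf h01 htop)).isCompact_closure

lemma le_indicator_closedSupport (h1 : ∀ x, f x ≤ 1) (x : Fin n → ℝ) :
    f x ≤ (closedSupport f).indicator (fun _ => 1) x := by
  by_cases hx : 0 < f x
  · have hx' : x ∈ closedSupport f := subset_closure (show x ∈ {x | 0 < f x} from hx)
    rw [indicator_of_mem hx']; exact h1 x
  · exact (not_lt.1 hx).trans (indicator_nonneg (fun _ _ => zero_le_one) x)

lemma ae_eq_indicator_closedSupport (hf : IsLogConcave f) (h01 : ∀ᵐ x, f x = 0 ∨ f x = 1) :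
    ∀ᵐ x, f x = (closedSupport f).indicator (fun _ => 1) x := by
  have hfr := measure_eq_zero_iff_ae_notMem.1 (hf.convex_support.addHaar_frontier volume)
  filter_upwards [h01, hfr] with x hx hxf
  by_cases hxC : x ∈ closedSupport f
  · rw [indicator_of_mem hxC]
    have hi : x ∈ interior {x | 0 < f x} := by
      by_contra hi; exact hxf ⟨hxC, hi⟩
    have hp : x ∈ {x | 0 < f x} := interior_subset hi
    exact hx.resolve_left (show 0 < f x from hp).ne'
  · rw [indicator_of_notMem hxC]
    exact le_antisymm (not_lt.1 fun hp => hxC (subset_closure hp)) (hf.1 x)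

/-- Upper semicontinuity makes {f ≥ 1} closed, and this set is dense in the interior of the support,
hence contains the closed support. -/
lemma eq_indicator_closedSupport_of_usc (hf : IsLogConcave f) (h1 : ∀ x, f x ≤ 1)
    (h01 : ∀ᵐ x, f x = 0 ∨ f x = 1) (hpos : weight f Finset.univ ≠ 0)
    (hu : UpperSemicontinuous f) (x : Fin n → ℝ) :
    f x = (closedSupport f).indicator (fun _ => 1) x := by
  refine le_antisymm (le_indicator_closedSupport h1 x) ?_
  by_cases hxC : x ∈ closedSupport f
  · rw [indicator_of_mem hxC]
    have hAi := interior_nonempty_of_measure_ne_zero volume hf.convex_support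
      (volume_support_ne_zero hpos)
    have hcl : IsClosed {x | 1 ≤ f x} := upperSemicontinuous_iff_isClosed_preimage.1 hu 1
    have hsub : closedSupport f ⊆ {x | 1 ≤ f x} := by
      rw [closedSupport, ← hf.convex_support.closure_interior_eq_closure_of_nonempty_interior hAi]
      refine closure_minimal (fun z hz => ?_) hcl
      rw [← hcl.closure_eq, mem_closure_iff]
      intro o ho hzo
      have hop := (ho.inter (isOpen_interior (s := {x | 0 < f x}))).measure_pos volume ⟨z, hzo, hz⟩
      by_contra hno
      refine hop.ne' (measure_eq_zero_iff_ae_notMem.2 ?_)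
      filter_upwards [h01] with w hw hwo
      refine hno ⟨w, hwo.1, ?_⟩
      have hp : w ∈ {x | 0 < f x} := interior_subset hwo.2
      exact (hw.resolve_left (show 0 < f w from hp).ne').ge
    exact hsub hxC
  · rw [indicator_of_notMem hxC]; exact hf.1 x

/-- In the equality case, `f` agrees with the indicator function of its closed support almost
everywhere on `H_S`. -/
lemma ae_section_eq_indicator (hf : IsLogConcave f) (h1 : ∀ x, f x ≤ 1)
    (h01 : ∀ᵐ x, f x = 0 ∨ f x = 1)
    (hle : weight f Finset.univ ≤ weight f S * weight f Sᶜ)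
    (htop : weight f Finset.univ ≠ ⊤) (hpos : weight f Finset.univ ≠ 0) :
    ∀ᵐ x ∂(sectionMeasure S), f x = (closedSupport f).indicator (fun _ => 1) x := by
  set χ : (Fin n → ℝ) → ℝ := (closedSupport f).indicator fun _ => 1 with hχ
  have hχc : IsLogConcave χ := isLogConcave_indicator hf.convex_support.closure
  have hχ1 : ∀ x, χ x ≤ 1 := fun x => indicator_le_self' (fun _ _ => zero_le_one) x
  have hmono : ∀ T, weight f T ≤ weight χ T := fun T =>
    mul_le_mul_right (lintegral_mono fun x =>
      ENNReal.ofReal_le_ofReal (le_indicator_closedSupport h1 x)) _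
  have huniv : weight χ Finset.univ = weight f Finset.univ := by
    rw [weight_univ, weight_univ]
    congr 1
    refine lintegral_congr_ae ?_
    filter_upwards [ae_eq_indicator_closedSupport hf h01] with x hx
    rw [hx]
  have hu : S ∪ Sᶜ = Finset.univ := Finset.union_compl S
  have hχm : weight χ S * weight χ Sᶜ ≤ weight χ Finset.univ := by
    rw [← hu]; exact hχc.weight_mul_le hχ1 disjoint_compl_right
  -- Squeeze: χ dominates f and has the same total weight. Supermultiplicativity for χ and equality
  -- for f then leave no room for a larger weight of χ on H_S.
  have hprod : weight χ S * weight f Sᶜ ≤ weight f S * weight f Sᶜ :=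
    ((mul_le_mul_right (hmono _) _).trans hχm).trans (huniv.le.trans hle)
  have hprod_top : weight f S * weight f Sᶜ ≠ ⊤ :=
    ((mul_le_mul' (hmono _) (hmono _)).trans (hχm.trans huniv.le)).trans_lt htop.lt_top |>.ne
  have hne : weight f S * weight f Sᶜ ≠ 0 := fun h0 => hpos (le_antisymm (h0 ▸ hle) zero_le)
  have htS : weight f S ≠ ⊤ := fun ht => by
    rw [ht, ENNReal.top_mul (right_ne_zero_of_mul hne)] at hprod_top; exact hprod_top rfl
  have htT : weight f Sᶜ ≠ ⊤ := fun ht => by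
    rw [ht, ENNReal.mul_top (left_ne_zero_of_mul hne)] at hprod_top; exact hprod_top rfl
  have hwle : weight χ S ≤ weight f S :=
    (ENNReal.mul_le_mul_iff_left (right_ne_zero_of_mul hne) htT).1 hprod
  have hfact : ((S.card.factorial : ℕ) : ℝ≥0∞) ≠ 0 := by simp [Nat.factorial_ne_zero]
  have hint : ∫⁻ x, ENNReal.ofReal (χ x) ∂(sectionMeasure S) ≤
      ∫⁻ x, ENNReal.ofReal (f x) ∂(sectionMeasure S) :=
    (ENNReal.mul_le_mul_iff_right hfact (by simp)).1 hwle
  have hfin : ∫⁻ x, ENNReal.ofReal (f x) ∂(sectionMeasure S) ≠ ⊤ := fun ht => by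
    rw [weight, ht, ENNReal.mul_top hfact] at htS; exact htS rfl
  have hae := ae_eq_of_ae_le_of_lintegral_le
    (ae_of_all _ fun x => ENNReal.ofReal_le_ofReal (le_indicator_closedSupport h1 x)) hfin
    (hχc.aemeasurable S).ennreal_ofReal hint
  filter_upwards [hae] with x hx
  exact (ENNReal.ofReal_eq_ofReal_iff (hf.1 x) (hχc.1 x)).1 hx

end Structure

/-! ### Bodies splitting along every member of the cover are block hulls, and conversely. -/

section BlockHull

variable {n m : ℕ} {C : Set (Fin n → ℝ)} {S : Finset (Fin n)}

/-- A point with coefficient 0 is replaced by the origin, so both points vanish wherever x does.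
This keeps earlier block supports intact when splitting along a further σ_j. -/
lemma SplitsAlong.exists_support (h : SplitsAlong S C) (h0 : 0 ∈ C) {x : Fin n → ℝ} (hx : x ∈ C) :
    ∃ a ∈ Icc (0 : ℝ) 1, ∃ c ∈ C, ∃ d ∈ C, x = a • c + (1 - a) • d ∧
      (∀ i, i ∉ S ∨ x i = 0 → c i = 0) ∧ ∀ i, i ∈ S ∨ x i = 0 → d i = 0 := by
  have aux : ∀ {T : Finset (Fin n)} {b : ℝ} {c : Fin n → ℝ}, c ∈ C → coordProj T x = b • c →
      ∃ c' ∈ C, coordProj T x = b • c' ∧ ∀ i, i ∉ T ∨ x i = 0 → c' i = 0 := by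
    intro T b c hc e
    by_cases hb : b = 0
    · exact ⟨0, h0, by rw [e, hb, zero_smul, zero_smul], fun _ _ => rfl⟩
    · refine ⟨c, hc, e, fun i hi => ?_⟩
      have e' := congrFun e i
      rw [coordProj_apply, Pi.smul_apply, smul_eq_mul] at e'
      have : b * c i = 0 := by
        rw [← e']; rcases hi with hi | hi <;> simp [hi]
      exact (mul_eq_zero.1 this).resolve_left hb
  obtain ⟨a, ha, c, hc, d, hd, e1, e2⟩ := h x hx
  obtain ⟨c', hc', e1', h1⟩ := aux hc e1
  obtain ⟨d', hd', e2', h2⟩ := aux hd e2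
  refine ⟨a, ha, c', hc', d', hd', ?_, h1, fun i hi => h2 i (by simpa using hi)⟩
  rw [← e1', ← e2', coordProj_add_compl]

lemma SplitsAlong.coordProj_mem (h : SplitsAlong S C) (hC : Convex ℝ C) (h0 : 0 ∈ C)
    {x : Fin n → ℝ} (hx : x ∈ C) : coordProj S x ∈ C ∧ coordProj Sᶜ x ∈ C := by
  obtain ⟨a, ha, c, hc, d, hd, e1, e2⟩ := h x hx
  rw [e1, e2]
  exact ⟨hC.smul_mem_of_zero_mem h0 hc ha,
    hC.smul_mem_of_zero_mem h0 hd ⟨by linarith [ha.2], by linarith [ha.1]⟩⟩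

/-- The block of the cover induced by the members of `σ` with index in `J` with sign vector `ε`. -/
def block (σ : Fin m → Finset (Fin n)) (J : Finset (Fin m)) (ε : Fin m → Bool) :
    Finset (Fin n) :=
  Finset.univ.filter fun i => ∀ j ∈ J, i ∈ (if ε j then (σ j)ᶜ else σ j)

lemma mem_block {σ : Fin m → Finset (Fin n)} {J : Finset (Fin m)} {ε : Fin m → Bool} {i : Fin n} :
    i ∈ block σ J ε ↔ ∀ j ∈ J, i ∈ (if ε j then (σ j)ᶜ else σ j) := by
  simp [block]

lemma mem_inducedCover {σ : Fin m → Finset (Fin n)} {τ : Finset (Fin n)} :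
    τ ∈ inducedCover σ ↔ (∃ ε, block σ Finset.univ ε = τ) ∧ τ.Nonempty := by
  simp [inducedCover, block]

lemma inducedCover_nonempty (hn : 1 ≤ n) (σ : Fin m → Finset (Fin n)) :
    (inducedCover σ).Nonempty := by
  refine ⟨block σ Finset.univ fun j => decide (⟨0, hn⟩ ∉ σ j), mem_inducedCover.2 ⟨⟨_, rfl⟩,
    ⟨0, hn⟩, mem_block.2 fun j _ => ?_⟩⟩
  by_cases h : (⟨0, hn⟩ : Fin n) ∈ σ j <;> simp [h]

/-- Induction on the index set: splitting along σ_j refines each block into its parts inside and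
outside σ_j. -/
lemma subset_convexHull_blocks {σ : Fin m → Finset (Fin n)} (h0 : 0 ∈ C)
    (h : ∀ j, SplitsAlong (σ j) C) (J : Finset (Fin m)) :
    C ⊆ convexHull ℝ (⋃ ε, {x ∈ C | ∀ i ∉ block σ J ε, x i = 0}) := by
  induction J using Finset.induction_on with
  | empty =>
    intro x hx
    refine subset_convexHull ℝ _ (mem_iUnion.2 ⟨fun _ => true, hx, fun i hi => ?_⟩)
    exact absurd (mem_block.2 (by simp)) hi
  | insert j J hj ih =>
    refine ih.trans (convexHull_min (iUnion_subset fun ε => ?_) (convex_convexHull ℝ _))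
    rintro x ⟨hx, hxε⟩
    obtain ⟨a, ha, c, hc, d, hd, e, hcs, hds⟩ := (h j).exists_support h0 hx
    have hupd : ∀ b : Bool, ∀ i, i ∈ (if b then (σ j)ᶜ else σ j) → i ∈ block σ J ε →
        i ∈ block σ (insert j J) (Function.update ε j b) := by
      intro b i hib hi
      refine mem_block.2 fun k hk => ?_
      by_cases hkj : k = j
      · subst hkj; simpa using hib
      · rw [Function.update_of_ne hkj]
        exact mem_block.1 hi k ((Finset.mem_insert.1 hk).resolve_left hkj)
    have hc' : c ∈ {x ∈ C | ∀ i ∉ block σ (insert j J) (Function.update ε j false), x i = 0} := by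
      refine ⟨hc, fun i hi => hcs i ?_⟩
      by_contra! hcon
      exact hi (hupd false i (by simpa using hcon.1) (by_contra fun hb => hcon.2 (hxε i hb)))
    have hd' : d ∈ {x ∈ C | ∀ i ∉ block σ (insert j J) (Function.update ε j true), x i = 0} := by
      refine ⟨hd, fun i hi => hds i ?_⟩
      by_contra! hcon
      exact hi (hupd true i (by simpa using hcon.1) (by_contra fun hb => hcon.2 (hxε i hb)))
    rw [e]
    exact convex_convexHull ℝ _
      (subset_convexHull ℝ _ (mem_iUnion.2 ⟨Function.update ε j false, hc'⟩))
      (subset_convexHull ℝ _ (mem_iUnion.2 ⟨Function.update ε j true, hd'⟩)) ha.1 (sub_nonneg.2 ha.2)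
      (by ring)

lemma coordProj_block_mem {σ : Fin m → Finset (Fin n)} (hC : Convex ℝ C) (h0 : 0 ∈ C)
    (h : ∀ j, SplitsAlong (σ j) C) (J : Finset (Fin m)) (ε : Fin m → Bool) {x : Fin n → ℝ}
    (hx : x ∈ C) : coordProj (block σ J ε) x ∈ C := by
  induction J using Finset.induction_on with
  | empty => rwa [coordProj_eq_self fun i hi => absurd (mem_block.2 (by simp)) hi]
  | insert j J hj ih =>
    have e : coordProj (block σ (insert j J) ε) x =
        coordProj (if ε j then (σ j)ᶜ else σ j) (coordProj (block σ J ε) x) := by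
      ext i
      simp only [coordProj_apply, mem_block, Finset.forall_mem_insert]
      by_cases h1 : i ∈ (if ε j then (σ j)ᶜ else σ j) <;> simp [h1]
    rw [e]
    have := (h j).coordProj_mem hC h0 ih
    split_ifs
    · exact this.2
    · exact this.1

lemma embed_restrict_of_support {x : Fin n → ℝ} (hx : ∀ i ∉ S, x i = 0) :
    embed S (fun i => x i) = x := by
  rw [embed_restrict, coordProj_eq_self hx]

/-- A convex body that splits along all members of `σ` is a block hull. -/
lemma isBlockHull_of_splitsAlong (hn : 1 ≤ n) {σ : Fin m → Finset (Fin n)} (hC : IsCompact C)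
    (hCc : Convex ℝ C) (hCi : (interior C).Nonempty) (h0 : 0 ∈ C)
    (h : ∀ j, SplitsAlong (σ j) C) : IsBlockHull σ C := by
  have hcl : ∀ τ : Finset (Fin n), Topology.IsClosedEmbedding (embed τ) := fun τ =>
    LinearMap.isClosedEmbedding_of_injective (f := embedLin τ)
      (LinearMap.ker_eq_bot.2 (embed_injective τ))
  refine ⟨fun τ => embed τ ⁻¹' C, fun τ hτ => ⟨⟨(hcl τ).isCompact_preimage hC,
    hCc.is_linear_preimage (embedLin τ).isLinear, ?_⟩, ?_⟩, ?_⟩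
  · obtain ⟨⟨ε, rfl⟩, -⟩ := mem_inducedCover.1 hτ
    have hopen : IsOpenMap (LinearMap.funLeft ℝ ℝ (Subtype.val : block σ Finset.univ ε → Fin n)) :=
      LinearMap.isOpenMap_of_finiteDimensional _
        (LinearMap.funLeft_surjective_of_injective ℝ ℝ _ Subtype.val_injective)
    -- Projection of C to a block stays in C and is an open map, so the image of the interior of C
    -- is an open subset of the section.
    refine (hCi.image _).mono (interior_maximal ?_ (hopen _ isOpen_interior))
    rintro _ ⟨x, hx, rfl⟩
    change embed _ (fun i => x i) ∈ C
    rw [embed_restrict]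
    exact coordProj_block_mem hCc h0 h _ _ (interior_subset hx)
  · change embed τ 0 ∈ C
    rwa [embed_zero]
  · refine Subset.antisymm ?_ (convexHull_min (iUnion₂_subset fun τ _ => image_preimage_subset _ _)
      hCc)
    refine (subset_convexHull_blocks h0 h Finset.univ).trans (convexHull_mono ?_)
    refine iUnion_subset fun ε => ?_
    rintro x ⟨hx, hxε⟩
    by_cases hne : (block σ Finset.univ ε).Nonempty
    · refine mem_iUnion₂.2 ⟨block σ Finset.univ ε, mem_inducedCover.2 ⟨⟨ε, rfl⟩, hne⟩,
        fun i => x i, ?_, embed_restrict_of_support hxε⟩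
      change embed _ _ ∈ C
      rwa [embed_restrict_of_support hxε]
    -- An empty block contributes only the origin, which belongs to the body of any induced block.
    · rw [Finset.not_nonempty_iff_eq_empty] at hne
      obtain rfl : x = 0 := by ext i; exact hxε i (by simp [hne])
      obtain ⟨τ, hτ⟩ := inducedCover_nonempty hn σ
      refine mem_iUnion₂.2 ⟨τ, hτ, 0, ?_, embed_zero τ⟩
      change embed τ 0 ∈ C
      rwa [embed_zero]

lemma IsBlockHull.convex {σ : Fin m → Finset (Fin n)} (h : IsBlockHull σ C) : Convex ℝ C := by
  obtain ⟨K, -, rfl⟩ := h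
  exact convex_convexHull ℝ _

lemma IsBlockHull.zero_mem {σ : Fin m → Finset (Fin n)} (hn : 1 ≤ n) (h : IsBlockHull σ C) :
    0 ∈ C := by
  obtain ⟨K, hK, rfl⟩ := h
  obtain ⟨τ, hτ⟩ := inducedCover_nonempty hn σ
  exact subset_convexHull ℝ _ (mem_iUnion₂.2 ⟨τ, hτ, 0, (hK τ hτ).2, embed_zero τ⟩)

open scoped Pointwise in
lemma exists_smul_eq_add (hC : Convex ℝ C) {a b : ℝ} (ha : 0 ≤ a) (hb : 0 ≤ b)
    {x y : Fin n → ℝ} (hx : x ∈ C) (hy : y ∈ C) : ∃ z ∈ C, a • x + b • y = (a + b) • z := by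
  have h : a • x + b • y ∈ (a + b) • C := by
    rw [hC.add_smul ha hb]
    exact add_mem_add (smul_mem_smul_set hx) (smul_mem_smul_set hy)
  obtain ⟨z, hz, e⟩ := h
  exact ⟨z, hz, e.symm⟩

/-- A block hull splits along every member of the cover. -/
lemma IsBlockHull.splitsAlong {σ : Fin m → Finset (Fin n)} (hn : 1 ≤ n) (h : IsBlockHull σ C)
    (j : Fin m) : SplitsAlong (σ j) C := by
  have hC := h.convex
  have h0 := h.zero_mem hn
  obtain ⟨K, hK, e⟩ := h
  set D : Set (Fin n → ℝ) := {z | ∃ a ∈ Icc (0 : ℝ) 1, ∃ c ∈ C, ∃ d ∈ C,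
    coordProj (σ j) z = a • c ∧ coordProj (σ j)ᶜ z = (1 - a) • d} with hD
  suffices hsub : C ⊆ D from fun z hz => hsub hz
  -- Since D is convex, only the pieces K_τ need checking, and each block lies wholly inside σ_j or
  -- wholly outside it. Convexity of D uses pC + qC = (p + q)C.
  have hDc : Convex ℝ D := by
    rintro z ⟨a, ha, c, hc, d, hd, e1, e2⟩ z' ⟨a', ha', c', hc', d', hd', e1', e2'⟩ p q hp hq hpq
    obtain ⟨c'', hc'', ec⟩ := exists_smul_eq_add hC (mul_nonneg hp ha.1)
      (mul_nonneg hq ha'.1) hc hc'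
    obtain ⟨d'', hd'', ed⟩ := exists_smul_eq_add hC (mul_nonneg hp (sub_nonneg.2 ha.2))
      (mul_nonneg hq (sub_nonneg.2 ha'.2)) hd hd'
    refine ⟨p * a + q * a', ⟨add_nonneg (mul_nonneg hp ha.1) (mul_nonneg hq ha'.1), ?_⟩,
      c'', hc'', d'', hd'', ?_, ?_⟩
    · nlinarith [ha.2, ha'.2]
    · rw [map_add, map_smul, map_smul, e1, e1', smul_smul, smul_smul, ec]
    · rw [map_add, map_smul, map_smul, e2, e2', smul_smul, smul_smul, ed]
      congr 1
      linear_combination hpq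
  nth_rewrite 1 [e]
  refine convexHull_min (iUnion₂_subset fun τ hτ => ?_) hDc
  rintro _ ⟨y, hy, rfl⟩
  have hyC : embed τ y ∈ C := by
    rw [e]; exact subset_convexHull ℝ _ (mem_iUnion₂.2 ⟨τ, hτ, y, hy, rfl⟩)
  obtain ⟨⟨ε, rfl⟩, -⟩ := mem_inducedCover.1 hτ
  by_cases hε : ε j
  · have hz : ∀ i ∈ σ j, embed (block σ Finset.univ ε) y i = 0 := by
      intro i hi
      refine embed_apply_notMem y fun hb => ?_
      have := mem_block.1 hb j (Finset.mem_univ j)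
      simp [hε, hi] at this
    refine ⟨0, ⟨le_rfl, zero_le_one⟩, 0, h0, _, hyC, ?_, ?_⟩
    · rw [coordProj_eq_zero hz, zero_smul]
    · rw [sub_zero, one_smul, coordProj_eq_self fun i hi => hz i (by simpa using hi)]
  · have hz : ∀ i ∉ σ j, embed (block σ Finset.univ ε) y i = 0 := by
      intro i hi
      refine embed_apply_notMem y fun hb => ?_
      have := mem_block.1 hb j (Finset.mem_univ j)
      simp [hε, hi] at this
    refine ⟨1, ⟨zero_le_one, le_rfl⟩, _, hyC, 0, h0, ?_, ?_⟩
    · rw [one_smul, coordProj_eq_self hz]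
    · rw [smul_zero, coordProj_eq_zero fun i hi => hz i (by simpa using hi)]

end BlockHull

/-! ### Multiplicativity of the weight for split bodies. -/

section Multiplicative

variable {n m : ℕ} {C : Set (Fin n → ℝ)} {S T : Finset (Fin n)}

lemma expo_le_of_forall {E : Set ℝ} {c : ℝ≥0∞}
    (h : ∀ r ∈ E, 0 < r → ENNReal.ofReal (Real.exp (-r)) ≤ c) : expo E ≤ c := by
  set A : Set ℝ := {a | 0 < a ∧ a ∈ E} with hA
  rcases A.eq_empty_or_nonempty with hAe | hAne
  · refine (measure_eq_zero_iff_ae_notMem.2 ?_).trans_le zero_le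
    filter_upwards [ae_expo_pos] with r hr hrE
    have : r ∈ A := ⟨hr, hrE⟩
    rw [hAe] at this; exact this
  have hb : BddBelow A := ⟨0, fun a ha => ha.1.le⟩
  have hN : 0 ≤ sInf A := le_csInf hAne fun a ha => ha.1.le
  have h1 : expo E ≤ ENNReal.ofReal (Real.exp (-sInf A)) := by
    rw [← expo_Ioi hN]
    refine measure_mono_ae ?_
    filter_upwards [ae_expo_pos, Measure.ae_ne expo (sInf A)] with r hr hr2 hr3
    exact lt_of_le_of_ne (csInf_le hb ⟨hr, hr3⟩) hr2.symm
  refine h1.trans (le_of_not_gt fun hcon => ?_)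
  have hc : ContinuousAt (fun a => ENNReal.ofReal (Real.exp (-a))) (sInf A) :=
    (ENNReal.continuous_ofReal.comp
      (by fun_prop : Continuous fun a : ℝ => Real.exp (-a))).continuousAt
  obtain ⟨δ, hδ, hball⟩ := Metric.eventually_nhds_iff.1 (hc.eventually (lt_mem_nhds hcon))
  obtain ⟨a, ha, haδ⟩ := exists_lt_of_csInf_lt hAne (lt_add_of_pos_right (sInf A) hδ)
  exact absurd (hball (y := a) (by
    rw [Real.dist_eq, abs_of_nonneg (sub_nonneg.2 (csInf_le hb ha))]; linarith))
    (not_lt.2 (h a ha.2 ha.1))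

lemma exp_le_rayIntegral_indicator (hC : Convex ℝ C) (h0 : 0 ∈ C) {b : ℝ} (hb : 0 ≤ b)
    {c : Fin n → ℝ} (hc : c ∈ C) :
    ENNReal.ofReal (Real.exp (-b)) ≤ rayIntegral (C.indicator fun _ => 1) (b • c) := by
  rw [← expo_Ioi hb, ← lintegral_indicator_one measurableSet_Ioi]
  refine lintegral_mono fun r => ?_
  by_cases hr : r ∈ Ioi b
  · have hbr : b < r := hr
    have hr0 : 0 < r := hb.trans_lt hbr
    have hm : r⁻¹ • b • c ∈ C := by
      rw [smul_smul]
      refine hC.smul_mem_of_zero_mem h0 hc ⟨by positivity, ?_⟩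
      rw [inv_mul_le_iff₀ hr0]; linarith
    simp [hm, hr]
  · rw [indicator_of_notMem hr]; exact zero_le

/-- If (x + y)/r lies in C, splitting writes x = (ra)c and y = (r(1 - a))d with c, d in C. The two
ray averages are then at least e^{-ra} and e^{-r(1-a)}, whose product is e^{-r}; the infimum of such
r controls the left side. -/
lemma SplitsAlong.rayIntegral_add_le (h : SplitsAlong S C) (hC : Convex ℝ C) (h0 : 0 ∈ C)
    {x y : Fin n → ℝ} (hx : ∀ i ∉ S, x i = 0) (hy : ∀ i ∈ S, y i = 0) :
    rayIntegral (C.indicator fun _ => 1) (x + y) ≤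
      rayIntegral (C.indicator fun _ => 1) x * rayIntegral (C.indicator fun _ => 1) y := by
  have hm : MeasurableSet {r : ℝ | r⁻¹ • (x + y) ∈ C} := by
    have h1 := (isLogConcave_indicator hC).measurable_ray (x + y) (measurableSet_singleton 1)
    convert h1 using 1
    ext r
    by_cases hr : r⁻¹ • (x + y) ∈ C
    · simp [hr, -smul_add]
    · simp [hr, -smul_add]
  have e : rayIntegral (C.indicator fun _ => 1) (x + y) = expo {r : ℝ | r⁻¹ • (x + y) ∈ C} := by
    rw [← lintegral_indicator_one hm]
    refine lintegral_congr fun r => ?_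
    by_cases hr : r⁻¹ • (x + y) ∈ C
    · simp [hr, -smul_add]
    · simp [hr, -smul_add]
  rw [e]
  refine expo_le_of_forall fun r hr hr0 => ?_
  obtain ⟨a, ha, c, hc, d, hd, e1, e2⟩ := h _ hr
  rw [map_smul, map_add, coordProj_eq_self hx, coordProj_eq_zero hy, add_zero,
    inv_smul_eq_iff₀ hr0.ne', smul_smul] at e1
  rw [map_smul, map_add, coordProj_eq_self (S := Sᶜ) (fun i hi => hy i (by simpa using hi)),
    coordProj_eq_zero (fun i hi => hx i (by simpa using hi)), zero_add,
    inv_smul_eq_iff₀ hr0.ne', smul_smul] at e2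
  have b1 : 0 ≤ r * a := mul_nonneg hr0.le ha.1
  have b2 : 0 ≤ r * (1 - a) := mul_nonneg hr0.le (sub_nonneg.2 ha.2)
  have b3 : -r = -(r * a) + -(r * (1 - a)) := by ring
  rw [b3, Real.exp_add, ENNReal.ofReal_mul (Real.exp_pos _).le, e1, e2]
  exact mul_le_mul' (exp_le_rayIntegral_indicator hC h0 b1 hc)
    (exp_le_rayIntegral_indicator hC h0 b2 hd)

lemma SplitsAlong.weight_union_le (h : SplitsAlong S C) (hC : Convex ℝ C) (h0 : 0 ∈ C)
    (hd : Disjoint S T) :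
    weight (C.indicator fun _ => 1) (S ∪ T) ≤
      weight (C.indicator fun _ => 1) S * weight (C.indicator fun _ => 1) T := by
  have hl := isLogConcave_indicator hC
  rw [hl.weight_mul_eq, hl.weight_eq,
    lintegral_sectionMeasure_union hd (hl.aemeasurable_rayIntegral _)]
  have haeS := Measure.quasiMeasurePreserving_fst (μ := sectionMeasure S)
    (ν := sectionMeasure T) |>.ae (ae_sectionMeasure_apply_eq_zero S)
  have haeT := Measure.quasiMeasurePreserving_snd (μ := sectionMeasure S)
    (ν := sectionMeasure T) |>.ae (ae_sectionMeasure_apply_eq_zero T)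
  refine lintegral_mono_ae ?_
  filter_upwards [haeS, haeT] with p hp hp'
  exact h.rayIntegral_add_le hC h0 hp fun i hi => hp' i (Finset.disjoint_left.1 hd hi)

lemma weight_empty (f : (Fin n → ℝ) → ℝ) : weight f ∅ = ENNReal.ofReal (f 0) := by
  simp [weight, sectionMeasure_empty]

end Multiplicative

/-! ### From two disjoint sets to one-reducible covers. -/

section Groups

variable {n m s : ℕ} {f : (Fin n → ℝ) → ℝ} {σ : Fin m → Finset (Fin n)} {g : Fin m → Fin s}

/-- Nonemptiness of J matters: the empty product is 1, while the weight of ∅ is f(0), which may be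
smaller. In the reverse inequality below, 0 ∈ C makes it equal to 1. -/
lemma IsLogConcave.prod_weight_le_biUnion (hf : IsLogConcave f) (h1 : ∀ x, f x ≤ 1)
    {J : Finset (Fin m)} (hJ : J.Nonempty) (hd : (J : Set (Fin m)).PairwiseDisjoint σ) :
    ∏ j ∈ J, weight f (σ j) ≤ weight f (J.biUnion σ) := by
  induction hJ using Finset.Nonempty.cons_induction with
  | singleton j => simp
  | cons j J hj hJ ih =>
    rw [Finset.prod_cons, Finset.cons_eq_insert, Finset.biUnion_insert]
    have hd' : (J : Set (Fin m)).PairwiseDisjoint σ :=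
      hd.subset (by simp)
    have hdj : Disjoint (σ j) (J.biUnion σ) := by
      rw [Finset.disjoint_biUnion_right]
      intro k hk
      exact hd (by simp) (by simp [hk]) fun e => hj (e ▸ hk)
    exact (mul_le_mul_right (ih hd') _).trans (hf.weight_mul_le h1 hdj)

lemma weight_biUnion_le_prod {C : Set (Fin n → ℝ)} (hC : Convex ℝ C) (h0 : 0 ∈ C)
    (hs : ∀ j, SplitsAlong (σ j) C) (J : Finset (Fin m))
    (hd : (J : Set (Fin m)).PairwiseDisjoint σ) :
    weight (C.indicator fun _ => 1) (J.biUnion σ) ≤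
      ∏ j ∈ J, weight (C.indicator fun _ => 1) (σ j) := by
  induction J using Finset.induction_on with
  | empty => simp [weight_empty, h0]
  | insert j J hj ih =>
    rw [Finset.prod_insert hj, Finset.biUnion_insert]
    have hdj : Disjoint (σ j) (J.biUnion σ) := by
      rw [Finset.disjoint_biUnion_right]
      intro k hk
      exact hd (by simp) (by simp [hk]) fun e => hj (e ▸ hk)
    exact ((hs j).weight_union_le hC h0 hdj).trans
      (mul_le_mul_right (ih (hd.subset (by simp))) _)

lemma existsUnique_mem (hg : ∀ t, IsCover 1 fun j : {j : Fin m // g j = t} => σ j) (t : Fin s)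
    (i : Fin n) : ∃! j, g j = t ∧ i ∈ σ j := by
  obtain ⟨⟨j, hj⟩, hj'⟩ := Finset.card_eq_one.1 (hg t i)
  have hmem : ∀ k : {j : Fin m // g j = t}, i ∈ σ k ↔ k = ⟨j, hj⟩ := by
    intro k
    have := Finset.ext_iff.1 hj' k
    simpa using this
  refine ⟨j, ⟨hj, (hmem ⟨j, hj⟩).2 rfl⟩, fun k hk => ?_⟩
  exact congrArg Subtype.val ((hmem ⟨k, hk.1⟩).1 hk.2)

lemma pairwiseDisjoint_group (hg : ∀ t, IsCover 1 fun j : {j : Fin m // g j = t} => σ j)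
    (t : Fin s) : ((Finset.univ.filter fun j => g j = t : Finset (Fin m)) :
      Set (Fin m)).PairwiseDisjoint σ := by
  intro j hj k hk hjk
  refine Finset.disjoint_left.2 fun i hi hi' => hjk ?_
  exact (existsUnique_mem hg t i).unique ⟨by simpa using hj, hi⟩ ⟨by simpa using hk, hi'⟩

lemma biUnion_group (hg : ∀ t, IsCover 1 fun j : {j : Fin m // g j = t} => σ j) (t : Fin s) :
    (Finset.univ.filter fun j => g j = t).biUnion σ = Finset.univ := by
  ext i
  obtain ⟨j, hj, -⟩ := existsUnique_mem hg t i
  simpa using ⟨j, hj⟩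

lemma group_nonempty (hn : 1 ≤ n) (hg : ∀ t, IsCover 1 fun j : {j : Fin m // g j = t} => σ j)
    (t : Fin s) : (Finset.univ.filter fun j => g j = t).Nonempty := by
  obtain ⟨j, hj, -⟩ := existsUnique_mem hg t ⟨0, hn⟩
  exact ⟨j, by simpa using hj.1⟩

lemma card_groups_le (hn : 1 ≤ n) (hg : ∀ t, IsCover 1 fun j : {j : Fin m // g j = t} => σ j) :
    s ≤ m := by
  have hsurj : Function.Surjective g := fun t => by
    obtain ⟨j, hj⟩ := group_nonempty hn hg t
    exact ⟨j, by simpa using hj⟩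
  simpa using Fintype.card_le_of_surjective g hsurj

lemma IsLogConcave.prod_group_le (hf : IsLogConcave f) (h1 : ∀ x, f x ≤ 1) (hn : 1 ≤ n)
    (hg : ∀ t, IsCover 1 fun j : {j : Fin m // g j = t} => σ j) (t : Fin s) :
    ∏ j with g j = t, weight f (σ j) ≤ weight f Finset.univ := by
  rw [← biUnion_group hg t]
  exact hf.prod_weight_le_biUnion h1 (group_nonempty hn hg t) (pairwiseDisjoint_group hg t)

/-- The inequality for a log-concave function bounded by one. -/
lemma IsLogConcave.prod_weight_le_pow (hf : IsLogConcave f) (h1 : ∀ x, f x ≤ 1) (hn : 1 ≤ n)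
    (hg : ∀ t, IsCover 1 fun j : {j : Fin m // g j = t} => σ j) :
    ∏ j, weight f (σ j) ≤ weight f Finset.univ ^ s := by
  rw [← Finset.prod_fiberwise (s := Finset.univ) (g := g)]
  refine (Finset.prod_le_prod' fun t _ => hf.prod_group_le h1 hn hg t).trans ?_
  simp

lemma weight_pow_le_prod {C : Set (Fin n → ℝ)} (hC : Convex ℝ C) (h0 : 0 ∈ C)
    (hs : ∀ j, SplitsAlong (σ j) C)
    (hg : ∀ t, IsCover 1 fun j : {j : Fin m // g j = t} => σ j) :
    weight (C.indicator fun _ => 1) Finset.univ ^ s ≤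
      ∏ j, weight (C.indicator fun _ => 1) (σ j) := by
  rw [← Finset.prod_fiberwise (s := Finset.univ) (g := g)]
  calc weight (C.indicator fun _ => 1) Finset.univ ^ s
      = ∏ _t : Fin s, weight (C.indicator fun _ => 1) Finset.univ := by simp
    _ ≤ _ := Finset.prod_le_prod' fun t _ => by
      rw [← biUnion_group hg t]
      exact weight_biUnion_le_prod hC h0 hs _ (pairwiseDisjoint_group hg t)

/-- In the equality case, the weight is multiplicative for each member and its complement. -/
lemma IsLogConcave.weight_univ_le_mul_compl (hf : IsLogConcave f) (h1 : ∀ x, f x ≤ 1) (hn : 1 ≤ n)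
    (hg : ∀ t, IsCover 1 fun j : {j : Fin m // g j = t} => σ j)
    (htop : weight f Finset.univ ≠ ⊤) (hpos : weight f Finset.univ ≠ 0)
    (hle : weight f Finset.univ ^ s ≤ ∏ j, weight f (σ j)) {j : Fin m}
    (hj : σ j ≠ Finset.univ) :
    weight f Finset.univ ≤ weight f (σ j) * weight f (σ j)ᶜ := by
  set w := weight f Finset.univ with hw
  set t := g j with ht
  set J : Finset (Fin m) := Finset.univ.filter fun k => g k = t with hJ
  -- The other s - 1 groups contribute at most w^{s-1}, which is finite and nonzero and can be
  -- cancelled.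
  have hgroup : w ≤ ∏ k ∈ J, weight f (σ k) := by
    rw [← Finset.prod_fiberwise (s := Finset.univ) (g := g),
      ← Finset.mul_prod_erase _ _ (Finset.mem_univ t)] at hle
    have hrest : ∏ t' ∈ Finset.univ.erase t, ∏ k with g k = t', weight f (σ k) ≤ w ^ (s - 1) := by
      refine (Finset.prod_le_prod' fun t' _ => hf.prod_group_le h1 hn hg t').trans ?_
      simp [Finset.card_erase_of_mem, hw]
    have hs : w ^ s = w * w ^ (s - 1) := (mul_pow_sub_one (by have := t.2; omega) w).symm
    rw [hs] at hle
    exact (ENNReal.mul_le_mul_iff_left (pow_ne_zero _ hpos) (ENNReal.pow_ne_top htop)).1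
      (hle.trans (mul_le_mul_right hrest _))
  have hjJ : j ∈ J := by simp [hJ, ht]
  -- The remaining members of the one-cover containing σ_j fill out exactly its complement.
  have hunion : (J.erase j).biUnion σ = (σ j)ᶜ := by
    ext i
    obtain ⟨k, hk, huniq⟩ := existsUnique_mem hg t i
    simp only [Finset.mem_biUnion, Finset.mem_erase, Finset.mem_compl, hJ, Finset.mem_filter,
      Finset.mem_univ, true_and]
    constructor
    · rintro ⟨l, ⟨hlj, hlt⟩, hil⟩ hij
      exact hlj ((huniq l ⟨hlt, hil⟩).trans (huniq j ⟨rfl, hij⟩).symm)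
    · intro hij
      exact ⟨k, ⟨fun e => hij (e ▸ hk.2), hk.1⟩, hk.2⟩
  have hne : (J.erase j).Nonempty := by
    rw [Finset.nonempty_iff_ne_empty]
    intro he
    rw [he, Finset.biUnion_empty] at hunion
    exact hj (Finset.compl_eq_empty_iff _ |>.1 hunion.symm)
  have hrest := hf.prod_weight_le_biUnion h1 hne
    ((pairwiseDisjoint_group hg t).subset (Finset.coe_subset.2 (Finset.erase_subset j J)))
  rw [hunion] at hrest
  rw [← Finset.mul_prod_erase _ _ hjJ] at hgroup
  exact hgroup.trans (mul_le_mul_right hrest _)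

/-- The structure of `f` in the equality case. -/
lemma IsLogConcave.eq_indicator_of_pow_le (hf : IsLogConcave f) (h1 : ∀ x, f x ≤ 1) (hn : 1 ≤ n)
    (hg : ∀ t, IsCover 1 fun j : {j : Fin m // g j = t} => σ j)
    (htop : weight f Finset.univ ≠ ⊤) (hpos : weight f Finset.univ ≠ 0)
    (hnt : ∃ j, (σ j).Nonempty ∧ σ j ≠ Finset.univ)
    (hle : weight f Finset.univ ^ s ≤ ∏ j, weight f (σ j)) :
    IsBlockHull σ (closedSupport f) ∧
      (∀ᵐ x, f x = (closedSupport f).indicator (fun _ => 1) x) ∧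
      (∀ j, ∀ᵐ x ∂(sectionMeasure (σ j)), f x = (closedSupport f).indicator (fun _ => 1) x) ∧
      (UpperSemicontinuous f → ∀ x, f x = (closedSupport f).indicator (fun _ => 1) x) := by
  have hmul : ∀ j, σ j ≠ Finset.univ →
      weight f Finset.univ ≤ weight f (σ j) * weight f (σ j)ᶜ := fun j hj =>
    hf.weight_univ_le_mul_compl h1 hn hg htop hpos hle hj
  have hcompl : ∀ j, σ j ≠ Finset.univ → (σ j)ᶜ.Nonempty := fun j hj => by
    rw [Finset.nonempty_iff_ne_empty]
    exact fun he => hj (Finset.compl_eq_empty_iff _ |>.1 he)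
  obtain ⟨j₀, hj₀, hj₀'⟩ := hnt
  have h01 := hf.ae_eq_zero_or_one h1 hj₀ (hcompl j₀ hj₀') (hmul j₀ hj₀') htop hpos
  have hcomp := hf.isCompact_closedSupport h01 htop hpos
  have h0 := (hf.splitsAlong_closedSupport h1 hj₀ (hcompl j₀ hj₀') (hmul j₀ hj₀') htop hpos
    hcomp).1
  have hC : Convex ℝ (closedSupport f) := hf.convex_support.closure
  have hsplit : ∀ j, SplitsAlong (σ j) (closedSupport f) := by
    intro j
    by_cases hu : σ j = Finset.univ
    · intro z hz
      refine ⟨1, ⟨zero_le_one, le_rfl⟩, z, hz, 0, h0, ?_, ?_⟩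
      · rw [one_smul, coordProj_eq_self fun i hi => absurd (hu ▸ Finset.mem_univ i) hi]
      · rw [smul_zero, coordProj_eq_zero fun i hi => by simp [hu] at hi]
    rcases (σ j).eq_empty_or_nonempty with he | hne
    · intro z hz
      refine ⟨0, ⟨le_rfl, zero_le_one⟩, 0, h0, z, hz, ?_, ?_⟩
      · rw [smul_zero, coordProj_eq_zero fun i hi => by simp [he] at hi]
      · rw [sub_zero, one_smul, coordProj_eq_self fun i hi => by simp [he] at hi]
    · exact (hf.splitsAlong_closedSupport h1 hne (hcompl j hu) (hmul j hu) htop hpos hcomp).2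
  have hae := ae_eq_indicator_closedSupport hf h01
  have hi : (interior (closedSupport f)).Nonempty :=
    (interior_nonempty_of_measure_ne_zero volume hf.convex_support
      (volume_support_ne_zero hpos)).mono (interior_mono subset_closure)
  refine ⟨isBlockHull_of_splitsAlong hn hcomp hC hi h0 hsplit, hae, fun j => ?_,
    eq_indicator_closedSupport_of_usc hf h1 h01 hpos⟩
  by_cases hu : σ j = Finset.univ
  · rw [hu, sectionMeasure_univ]; exact hae
  · exact ae_section_eq_indicator hf h1 h01 (hmul j hu) htop hpos

lemma weight_pow_eq_prod_of_isBlockHull {C : Set (Fin n → ℝ)} (hn : 1 ≤ n)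
    (hg : ∀ t, IsCover 1 fun j : {j : Fin m // g j = t} => σ j) (hC : IsBlockHull σ C)
    (hae : ∀ᵐ x, f x = C.indicator (fun _ => 1) x)
    (hsec : ∀ j, ∀ᵐ x ∂(sectionMeasure (σ j)), f x = C.indicator (fun _ => 1) x) :
    weight f Finset.univ ^ s = ∏ j, weight f (σ j) := by
  have key : ∀ S : Finset (Fin n), (∀ᵐ x ∂(sectionMeasure S), f x = C.indicator (fun _ => 1) x) →
      weight f S = weight (C.indicator fun _ => 1) S := by
    intro S hS
    unfold weight
    congr 1
    refine lintegral_congr_ae ?_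
    filter_upwards [hS] with x hx
    rw [hx]
  rw [key _ (by rwa [sectionMeasure_univ]), Finset.prod_congr rfl fun j _ => key _ (hsec j)]
  refine le_antisymm (weight_pow_le_prod hC.convex (hC.zero_mem hn) (hC.splitsAlong hn) hg) ?_
  exact (isLogConcave_indicator hC.convex).prod_weight_le_pow
    (fun x => indicator_le_self' (fun _ _ => zero_le_one) x) hn hg

end Groups

/-! ### Normalization of the supremum and the theorem. -/

section Normalization

variable {n m s : ℕ} {f : (Fin n → ℝ) → ℝ} {σ : Fin m → Finset (Fin n)}

lemma leftSide_mul : leftSide m s f * (n.factorial : ℝ≥0∞) ^ s =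
    supNorm f ^ (m - s) * weight f Finset.univ ^ s := by
  rw [leftSide, weight_univ, mul_pow]
  ring

lemma rightSide_mul : rightSide s σ f * (n.factorial : ℝ≥0∞) ^ s = ∏ j, weight f (σ j) := by
  have h : (n.factorial : ℝ≥0∞) ^ s ≠ 0 := pow_ne_zero _ (by simp [Nat.factorial_ne_zero])
  have h' : (n.factorial : ℝ≥0∞) ^ s ≠ ⊤ := ENNReal.pow_ne_top (by simp)
  simp only [rightSide, weight, Finset.prod_mul_distrib]
  rw [mul_right_comm, ENNReal.div_mul_cancel h h']

lemma weight_div {M : ℝ} (hM : 0 < M) (S : Finset (Fin n)) :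
    weight f S = ENNReal.ofReal M * weight (fun x => f x / M) S := by
  rw [weight, weight, mul_left_comm, ← lintegral_const_mul' _ _ ENNReal.ofReal_ne_top]
  congr 1
  refine lintegral_congr fun x => ?_
  rw [← ENNReal.ofReal_mul hM.le, mul_div_cancel₀ _ hM.ne']

lemma IsLogConcave.ofReal_le_supNorm (hf : IsLogConcave f) (x : Fin n → ℝ) :
    ENNReal.ofReal (f x) ≤ supNorm f := by
  rw [← Real.enorm_of_nonneg (hf.1 x)]
  exact le_iSup (fun x => ‖f x‖ₑ) x

/-- If `∫ f = 0`, then the right-hand side vanishes as well. -/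
lemma IsLogConcave.prod_weight_eq_zero (hf : IsLogConcave f) (hn : 1 ≤ n) (hs : s ≠ 0)
    {g : Fin m → Fin s} (hg : ∀ t, IsCover 1 fun j : {j : Fin m // g j = t} => σ j)
    (h0 : weight f Finset.univ = 0) : ∏ j, weight f (σ j) = 0 := by
  -- With zero integral f may still be unbounded on a null set. Truncation at 1 preserves
  -- log-concavity and the vanishing of every section integral, so the bounded case applies.
  have hiff : ∀ S, weight (fun x => min (f x) 1) S = 0 ↔ weight f S = 0 := by
    intro S
    have hfact : ((S.card.factorial : ℕ) : ℝ≥0∞) ≠ 0 := by simp [Nat.factorial_ne_zero]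
    unfold weight
    rw [mul_eq_zero, mul_eq_zero, or_iff_right hfact, or_iff_right hfact,
      lintegral_eq_zero_iff' (hf.min_one.aemeasurable S).ennreal_ofReal,
      lintegral_eq_zero_iff' (hf.aemeasurable S).ennreal_ofReal]
    refine Filter.eventually_congr (ae_of_all _ fun x => ?_)
    simp [ENNReal.ofReal_eq_zero]
  have h := hf.min_one.prod_weight_le_pow (fun x => min_le_right _ _) hn hg
  rw [(hiff _).2 h0, zero_pow hs, nonpos_iff_eq_zero, Finset.prod_eq_zero_iff] at h
  obtain ⟨j, hj, hj0⟩ := h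
  exact Finset.prod_eq_zero hj ((hiff _).1 hj0)

end Normalization

end RogersShephard

open RogersShephard in
theorem theorem1p1 {n m s : ℕ} (hn : 1 ≤ n) (f : (Fin n → ℝ) → ℝ)
    (hf : RogersShephard.IsLogConcave f) (hfi : Integrable f)
    (σ : Fin m → Finset (Fin n)) (hσ : RogersShephard.IsCover s σ)
    (hred : RogersShephard.IsOneReducible s σ) :
    RogersShephard.rightSide s σ f ≤ RogersShephard.leftSide m s f ∧
    ((∃ j, (σ j).Nonempty ∧ σ j ≠ Finset.univ) →
      (RogersShephard.leftSide m s f = RogersShephard.rightSide s σ f ↔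
        (∫ x, f x) = 0 ∨
        ∃ C : Set (Fin n → ℝ), RogersShephard.IsBlockHull σ C ∧
          (∀ᵐ x, RogersShephard.AgreesAt f C x) ∧
          ∀ j, ∀ᵐ x ∂(RogersShephard.sectionMeasure (σ j)), RogersShephard.AgreesAt f C x) ∧
      (UpperSemicontinuous f →
        (RogersShephard.leftSide m s f = RogersShephard.rightSide s σ f ↔
          (∫ x, f x) = 0 ∨
          ∃ C : Set (Fin n → ℝ), RogersShephard.IsBlockHull σ C ∧
            ∀ x, RogersShephard.AgreesAt f C x))) := by
  obtain ⟨g, hg⟩ := hred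
  have hsm : s ≤ m := card_groups_le hn hg
  have hA0 : (n.factorial : ℝ≥0∞) ^ s ≠ 0 := pow_ne_zero _ (by simp [Nat.factorial_ne_zero])
  have hAt : (n.factorial : ℝ≥0∞) ^ s ≠ ⊤ := ENNReal.pow_ne_top (by simp)
  have hint : ENNReal.ofReal (∫ x, f x) = ∫⁻ x, ENNReal.ofReal (f x) :=
    ofReal_integral_eq_lintegral_ofReal hfi (ae_of_all _ hf.1)
  by_cases hz : ∫ x, f x = 0
  · have hw : weight f Finset.univ = 0 := by rw [weight_univ, ← hint, hz]; simp
    by_cases hs : s = 0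
    · subst hs
      obtain rfl : m = 0 := Nat.eq_zero_of_not_pos fun hm => (g ⟨0, hm⟩).elim0
      refine ⟨by simp [leftSide, rightSide], fun ⟨j, _⟩ => j.elim0⟩
    have hl : leftSide m s f = 0 := by
      rw [leftSide, ← hint, hz, ENNReal.ofReal_zero, zero_pow hs, mul_zero]
    have hr : rightSide s σ f = 0 := by
      have h := rightSide_mul (s := s) (σ := σ) (f := f)
      rw [hf.prod_weight_eq_zero hn hs hg hw] at h
      exact (mul_eq_zero.1 h).resolve_right hA0
    rw [hl, hr]
    simp [hz]
  have hw0 : ∫⁻ x, ENNReal.ofReal (f x) ≠ 0 := by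
    rw [← hint]
    exact (ENNReal.ofReal_pos.2 ((integral_nonneg hf.1).lt_of_ne' hz)).ne'
  have hwt : ∫⁻ x, ENNReal.ofReal (f x) ≠ ⊤ := by rw [← hint]; exact ENNReal.ofReal_ne_top
  obtain ⟨B, hB⟩ := hf.bddAbove hw0 hwt
  have hMt : supNorm f ≠ ⊤ := by
    refine ((iSup_le fun x => ?_ : supNorm f ≤ ENNReal.ofReal B).trans_lt ENNReal.ofReal_lt_top).ne
    rw [Real.enorm_of_nonneg (hf.1 x)]
    exact ENNReal.ofReal_le_ofReal (hB x)
  have hM0 : supNorm f ≠ 0 := by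
    intro h0
    refine hw0 (lintegral_eq_zero_of_ae_eq_zero (ae_of_all _ fun x => ?_))
    exact le_antisymm ((hf.ofReal_le_supNorm x).trans_eq h0) zero_le
  set M := (supNorm f).toReal with hMdef
  have hM : 0 < M := ENNReal.toReal_pos hM0 hMt
  have hMeq : supNorm f = ENNReal.ofReal M := (ENNReal.ofReal_toReal hMt).symm
  set F : (Fin n → ℝ) → ℝ := fun x => f x / M with hFdef
  have hF : IsLogConcave F := hf.div hM
  have hF1 : ∀ x, F x ≤ 1 := by
    intro x
    rw [hFdef, div_le_one hM]
    exact (ENNReal.ofReal_le_ofReal_iff hM.le).1 (hMeq ▸ hf.ofReal_le_supNorm x)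
  have hFw : ∀ S, weight f S = ENNReal.ofReal M * weight F S := weight_div hM
  have hMp0 : ENNReal.ofReal M ^ m ≠ 0 := pow_ne_zero _ (hMeq ▸ hM0)
  have hMpt : ENNReal.ofReal M ^ m ≠ ⊤ := ENNReal.pow_ne_top ENNReal.ofReal_ne_top
  -- Both sides are homogeneous of degree m in f; on the left this is (m - s) + s = m, which needs s
  -- ≤ m because the subtraction is truncated.
  have hleft : leftSide m s f * (n.factorial : ℝ≥0∞) ^ s =
      ENNReal.ofReal M ^ m * weight F Finset.univ ^ s := by
    rw [leftSide_mul, hFw, hMeq, mul_pow, ← mul_assoc, ← pow_add, Nat.sub_add_cancel hsm]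
  have hright : rightSide s σ f * (n.factorial : ℝ≥0∞) ^ s =
      ENNReal.ofReal M ^ m * ∏ j, weight F (σ j) := by
    rw [rightSide_mul, Finset.prod_congr rfl fun j _ => hFw (σ j), Finset.prod_mul_distrib]
    simp
  have hrl : rightSide s σ f ≤ leftSide m s f ↔
      ∏ j, weight F (σ j) ≤ weight F Finset.univ ^ s := by
    rw [← ENNReal.mul_le_mul_iff_left hA0 hAt, hleft, hright,
      ENNReal.mul_le_mul_iff_right hMp0 hMpt]
  have hlr : leftSide m s f ≤ rightSide s σ f ↔
      weight F Finset.univ ^ s ≤ ∏ j, weight F (σ j) := by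
    rw [← ENNReal.mul_le_mul_iff_left hA0 hAt, hleft, hright,
      ENNReal.mul_le_mul_iff_right hMp0 hMpt]
  have hineq : rightSide s σ f ≤ leftSide m s f := hrl.2 (hF.prod_weight_le_pow hF1 hn hg)
  have hagree : ∀ (C : Set (Fin n → ℝ)) x, AgreesAt f C x ↔ F x = C.indicator (fun _ => 1) x := by
    intro C x
    have hfx : f x = M * F x := by rw [hFdef, mul_div_cancel₀ _ hM.ne']
    by_cases hx : x ∈ C
    · rw [AgreesAt, indicator_of_mem hx, indicator_of_mem hx, hMeq, Pi.one_apply, mul_one,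
        ENNReal.ofReal_eq_ofReal_iff (hf.1 x) hM.le, hFdef, div_eq_one_iff_eq hM.ne']
    · rw [AgreesAt, indicator_of_notMem hx, indicator_of_notMem hx, mul_zero,
        ENNReal.ofReal_eq_zero, hFdef, div_eq_zero_iff, or_iff_left hM.ne']
      exact ⟨fun h => le_antisymm h (hf.1 x), fun h => h.le⟩
  have hFu : weight F Finset.univ ≠ 0 ∧ weight F Finset.univ ≠ ⊤ := by
    have h := hFw Finset.univ
    rw [weight_univ] at h
    have hn0 : ((n.factorial : ℕ) : ℝ≥0∞) ≠ 0 := by simp [Nat.factorial_ne_zero]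
    constructor
    · intro h0
      rw [h0, mul_zero] at h
      exact (mul_ne_zero hn0 hw0) h
    · intro ht
      rw [ht, ENNReal.mul_top (hMeq ▸ hM0)] at h
      exact (ENNReal.mul_ne_top (by simp) hwt) h
  have hconv : ∀ C : Set (Fin n → ℝ), IsBlockHull σ C → (∀ᵐ x, AgreesAt f C x) →
      (∀ j, ∀ᵐ x ∂(sectionMeasure (σ j)), AgreesAt f C x) →
      leftSide m s f = rightSide s σ f := by
    intro C hC hae hsec
    simp only [hagree] at hae hsec
    exact le_antisymm (hlr.2 (weight_pow_eq_prod_of_isBlockHull hn hg hC hae hsec).le) hineq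
  refine ⟨hineq, fun hnt => ?_⟩
  have hstruct : leftSide m s f = rightSide s σ f → _ := fun he =>
    hF.eq_indicator_of_pow_le hF1 hn hg hFu.2 hFu.1 hnt (hlr.1 he.le)
  refine ⟨⟨fun he => ?_, ?_⟩, fun hu => ⟨fun he => ?_, ?_⟩⟩
  · obtain ⟨hC, hae, hsec, -⟩ := hstruct he
    refine Or.inr ⟨closedSupport F, hC, ?_, fun j => ?_⟩
    · simpa only [hagree] using hae
    · simpa only [hagree] using hsec j
  · rintro (h | ⟨C, hC, hae, hsec⟩)
    · exact absurd h hz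
    · exact hconv C hC hae hsec
  · obtain ⟨hC, -, -, husc⟩ := hstruct he
    have huF : UpperSemicontinuous F := by
      rw [upperSemicontinuous_iff_isClosed_preimage] at hu ⊢
      intro y
      convert hu (y * M) using 1
      ext x
      exact le_div_iff₀ hM
    exact Or.inr ⟨closedSupport F, hC, fun x => (hagree _ x).2 (husc huF x)⟩
  · rintro (h | ⟨C, hC, hall⟩)
    · exact absurd h hz
    · exact hconv C hC (ae_of_all _ hall) fun j => ae_of_all _ hall
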